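/- **Setting.** Let $d\ge 1$. At each time $t=1,\dots,T$ a context $X_t\in[0,1]^d$ is drawn i.i.d. from $\mathbf P_X$, one of two arms $k\in\{1,2\}$ is selected, and a reward $Y_{k,t}\in\{0,1\}$ with $\mathbb E[Y_{k,t}\mid X_t]=f_k(X_t)$ is observed. The regret of a policy $\pi$ on the problem $\mathsf P=(\mathbf P_X,\mathbf P^{(1)}_{Y|X},\mathbf P^{(2)}_{Y|X})$ is $\mathcal R^\pi(\mathsf P;T)=\mathbb E^\pi\big[\sum_{t=1}^T \max_k f_k(X_t)-f_{\pi_t}(X_t)\big]$. For $0<\beta\le 1$, $\alpha>0$ and constants $L,C_0>0$, $0<\underline\rho\le\bar\rho$, let $\mathcal P(\beta,\alpha,d)=\mathcal P(\beta,L,\alpha,C_0,\underline\rho,\bar\rho)$ be the class of problems such that $|f_k(x)-f_k(x')|\le L\|x-x'\|_\infty^\beta$ for $x,x'\in[0,1]^d$ and $k=1,2$; $\mathbf P_X$ has a Lebesgue density on $[0,1]^d$ with values in $[\underline\rho,\bar\rho]$; and $\mathbf P_X\{0<|f_1(X)-f_2(X)|\le\delta\}\le C_0\delta^\alpha$ for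 all $0<\delta\le 1$. Put $\zeta(\beta,\alpha,d)=1-\frac{\beta(1+\alpha)}{2\beta+d}$. **Policy.** $\mathrm{ABSE}(\tilde\beta)$ (Adaptively Binned Successive Elimination, Perchet and Rigollet 2013) with horizon $T$ and tuning constant $c_0>0$ maintains a partition of $[0,1]^d$ into live dyadic bins, initially the whole cube. For a bin $B$ write $|B|$ for its side length, and let $U(\tau,S)=2\sqrt{2\max(\log(S/\tau),1)/\tau}$. When a context falls in a live bin $B$, the successive elimination procedure of $B$, started with both arms when $B$ becomes live, makes one pull: in each round every active arm is pulled once; after round $\tau$, an arm whose average reward in $B$ is smaller than the largest one by more than $2U(\tau,T|B|^d)$ is eliminated in $B$. If both arms survive $\ell_B$ rounds in $B$ and $|B|=2^{-k}$ with $k<k_0$, then $B$ is replaced by its $2^d$ dyadic children. Here $\ell_B\ge1$ is the least integer with $U(\ell_B,T|B|^d)\le 2c_0|B|^{\tilde\beta}$, and $k_0\ge 0$ is the least integer with $2^{-k_0}\le(2\log 2/T)^{1/(2\tilde\beta+d)}$. **Claim.** Let $0<\beta\le1$, $0<\alpha\le 1/\beta$ and $L>0$. There is $C_{\min}>0$,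 depending only on $d,\beta,\alpha,L$, such that the following holds for all $C_0>0$ (with $C_0\ge C_{\min}$ in the extreme case $\alpha\beta=d=1$), all $0<\underline\rho\le 1\le\bar\rho$, all $0<\tilde\beta\le1$ and all $c_0>0$. There are constants $\underline C>0$ and $T_0$, independent of $T$, such that for all $T\ge T_0$: 1. if $\tilde\beta<\beta$, then $\displaystyle\sup_{\mathsf P\in\mathcal P(\beta,\alpha,d)}\mathcal R^{\mathrm{ABSE}(\tilde\beta)}(\mathsf P;T)\ge \underline C\,T^{\zeta(\tilde\beta,\alpha,d)}$; 2. if $\beta<\tilde\beta$, then $\displaystyle\sup_{\mathsf P\in\mathcal P(\beta,\alpha,d)}\mathcal R^{\mathrm{ABSE}(\tilde\beta)}(\mathsf P;T)\ge \underline C\,T$. -/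

import Mathlib

open MeasureTheory ProbabilityTheory
open scoped ENNReal

/-- Contexts: the cube `[0,1]^d`. Its distance is the sup-norm distance and its `volume` is the
Lebesgue measure. -/
abbrev Context (d : ℕ) : Type := Fin d → unitInterval

/-- The two arms. -/
abbrev Arm : Type := Fin 2

/-! ### Problem instances -/

/-- A problem instance: the law of the context and, for each arm, the conditional law of the
binary reward given the context (`true` stands for the reward `1`, `false` for the reward `0`). -/
structure Problem (d : ℕ) where
  covariate : Measure (Context d)
  reward : Arm → Kernel (Context d) Bool
  isProbabilityMeasure_covariate : IsProbabilityMeasure covariate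
  isMarkovKernel_reward : ∀ k, IsMarkovKernel (reward k)

attribute [instance] Problem.isProbabilityMeasure_covariate Problem.isMarkovKernel_reward

namespace Problem

variable {d : ℕ}

/-- The payoff function `f_k(x) = E[Y_k | X = x]`, i.e. the conditional probability of reward `1`. -/
noncomputable def payoff (P : Problem d) (k : Arm) (x : Context d) : ℝ :=
  (P.reward k x).real {true}

/-- The law of `(X_t, (Y_{1,t}, Y_{2,t}))` in one period. -/
noncomputable def stepLaw (P : Problem d) : Measure (Context d × (Bool × Bool)) :=
  P.covariate ⊗ₘ (P.reward 0 ×ₖ P.reward 1)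

instance (P : Problem d) : IsProbabilityMeasure P.stepLaw := by
  unfold stepLaw; infer_instance

/-- The law of the i.i.d. sequence of contexts and potential rewards. -/
noncomputable def law (P : Problem d) : Measure (ℕ → Context d × (Bool × Bool)) :=
  Measure.infinitePi fun _ => P.stepLaw

/-- Hölder smoothness for an exponent `0 < β ≤ 1`: the Taylor polynomial involved has degree the
largest integer strictly less than `β`, which is `0`, so it is the constant `f x`. -/
def IsHolderSmooth (P : Problem d) (β L : ℝ) : Prop :=
  ∀ k : Arm, ∀ x y : Context d, |P.payoff k y - P.payoff k x| ≤ L * dist x y ^ β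

/-- The context law has a Lebesgue density with values in `[ρlo, ρhi]`. -/
def HasDensityBounds (P : Problem d) (ρlo ρhi : ℝ) : Prop :=
  ∃ p : Context d → ℝ, Measurable p ∧ (∀ x, ρlo ≤ p x ∧ p x ≤ ρhi) ∧
    P.covariate = volume.withDensity fun x => ENNReal.ofReal (p x)

/-- The margin condition with exponent `α` and constant `C₀`. -/
def HasMargin (P : Problem d) (α C₀ : ℝ) : Prop :=
  ∀ δ : ℝ, 0 < δ → δ ≤ 1 →
    P.covariate.real {x | 0 < |P.payoff 0 x - P.payoff 1 x| ∧ |P.payoff 0 x - P.payoff 1 x| ≤ δ}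
      ≤ C₀ * δ ^ α

end Problem

/-- The class of problems `𝒫(β, L, α, C₀, ρlo, ρhi)` in dimension `d`, for `0 < β ≤ 1`. -/
def problemClass (d : ℕ) (β L α C₀ ρlo ρhi : ℝ) : Set (Problem d) :=
  {P | P.IsHolderSmooth β L ∧ P.HasDensityBounds ρlo ρhi ∧ P.HasMargin α C₀}

/-! ### Policies and regret -/

/-- What is observed in one period: the context, the selected arm, and the reward of that arm. -/
abbrev Observation (d : ℕ) : Type := Context d × Arm × Bool

/-- A (non-randomized) policy selects an arm from the past observations, listed with the most
recent one first, and the current context. -/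
abbrev Policy (d : ℕ) : Type := List (Observation d) → Context d → Arm

namespace Policy

variable {d : ℕ}

/-- The observations of the first `t` periods, most recent first, when `π` is run on the sequence
`ω` of contexts and potential rewards. -/
def history (π : Policy d) (ω : ℕ → Context d × (Bool × Bool)) : ℕ → List (Observation d)
  | 0 => []
  | t + 1 =>
    let x := (ω t).1
    let a := π (history π ω t) x
    (x, a, if a = 0 then (ω t).2.1 else (ω t).2.2) :: history π ω t

/-- The arm selected in period `t` (periods are numbered from `0`). -/
def action (π : Policy d) (ω : ℕ → Context d × (Bool × Bool)) (t : ℕ) : Arm :=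
  π (history π ω t) (ω t).1

/-- The expected regret over `T` periods relative to the oracle, which collects
`max (f_1(X_t), f_2(X_t))` in period `t`. All the summands are nonnegative. -/
noncomputable def regret (π : Policy d) (P : Problem d) (T : ℕ) : ℝ≥0∞ :=
  ∫⁻ ω, ENNReal.ofReal (∑ t ∈ Finset.range T,
    (max (P.payoff 0 (ω t).1) (P.payoff 1 (ω t).1) - P.payoff (π.action ω t) (ω t).1)) ∂P.law

end Policy

/-- The exponent `ζ(β, α, d) = 1 - β (1 + α) / (2 β + d)`. -/
noncomputable def zetaExponent (β α : ℝ) (d : ℕ) : ℝ := 1 - β * (1 + α) / (2 * β + d)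

/-! ### The Adaptively Binned Successive Elimination policy -/

namespace ABSE

/-- A dyadic bin: its depth `k` (the side length is `2 ^ (-k)`) and its integer coordinates. -/
abbrev Bin (d : ℕ) : Type := ℕ × (Fin d → ℕ)

/-- The dyadic bin of depth `k` containing `x`; the upper faces of the cube belong to the last
bins. -/
noncomputable def binOf {d : ℕ} (k : ℕ) (x : Context d) : Bin d :=
  (k, fun i => min ⌊2 ^ k * (x i : ℝ)⌋₊ (2 ^ k - 1))

/-- The confidence radius `U(τ, S) = 2 √(2 max(log(S/τ), 1) / τ)`. -/
noncomputable def radius (τ : ℕ) (S : ℝ) : ℝ :=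
  2 * Real.sqrt (2 * max (Real.log (S / τ)) 1 / τ)

/-- The parameter `T |B|^d` of the successive elimination run in a bin `B` of depth `k`. -/
noncomputable def localHorizon (d T k : ℕ) : ℝ := T * ((2 : ℝ)⁻¹ ^ k) ^ d

/-- The number of rounds `ℓ_B` after which a bin `B` of depth `k` is split: the least `l ≥ 1` with
`U(l, T |B|^d) ≤ 2 c₀ |B|^b`. -/
noncomputable def maxRounds (d : ℕ) (b c₀ : ℝ) (T k : ℕ) : ℕ :=
  sInf {l : ℕ | 1 ≤ l ∧ radius l (localHorizon d T k) ≤ 2 * c₀ * ((2 : ℝ)⁻¹ ^ k) ^ b}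

/-- The maximal depth `k₀`: the least `k` with `2 ^ (-k) ≤ (K log K / T) ^ (1 / (2 b + d))`, where
`K = 2` is the number of arms. -/
noncomputable def maxDepth (d : ℕ) (b : ℝ) (T : ℕ) : ℕ :=
  sInf {k : ℕ | (2 : ℝ)⁻¹ ^ k ≤ (2 * Real.log 2 / T) ^ (1 / (2 * b + d))}

/-- The state of the successive elimination run in one bin: the arms that are still active, the
number of pulls of each arm, the sum of the rewards of each arm, and whether the bin has been split
into its `2 ^ d` children. -/
structure BinState where
  active : Finset Arm
  pulls : Arm → ℕ
  total : Arm → ℕ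
  split : Prop

/-- The initial state of a bin. A bin is split only while both arms are active, so that its
children always start with both arms. -/
def BinState.init : BinState where
  active := Finset.univ
  pulls := fun _ => 0
  total := fun _ => 0
  split := False

/-- The average reward of arm `i` in the bin. -/
noncomputable def BinState.mean (s : BinState) (i : Arm) : ℝ := (s.total i : ℝ) / (s.pulls i : ℝ)

/-- In each round the active arms are pulled once each, in increasing order. -/
def BinState.nextArm (s : BinState) : Arm :=
  if 0 ∈ s.active ∧ (1 ∈ s.active → s.pulls 0 ≤ s.pulls 1) then 0 else 1

/-- Record a pull of arm `a` with reward `y`. -/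
def BinState.record (s : BinState) (a : Arm) (y : Bool) : BinState :=
  { s with
    pulls := Function.update s.pulls a (s.pulls a + 1)
    total := Function.update s.total a (s.total a + if y then 1 else 0) }

open Classical in
/-- At the end of a round `τ` in which both arms were active, eliminate the arms whose average is
below the largest average by more than `2 U(τ, T |B|^d)`; if both arms survive, `ℓ_B` rounds are
completed and the maximal depth is not reached, then split the bin. -/
noncomputable def BinState.endRound (d : ℕ) (b c₀ : ℝ) (T k : ℕ) (s : BinState) : BinState :=
  if s.active = Finset.univ ∧ s.pulls 0 = s.pulls 1 then
    let survivors : Finset Arm := Finset.univ.filter fun i =>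
      ∀ j, s.mean j - 2 * radius (s.pulls 0) (localHorizon d T k) ≤ s.mean i
    { s with
      active := survivors
      split := survivors = Finset.univ ∧ maxRounds d b c₀ T k ≤ s.pulls 0 ∧ k < maxDepth d b T }
  else s

/-- The live bin containing `x`: the largest dyadic bin containing `x` that has not been split. -/
noncomputable def liveBin {d : ℕ} (st : Bin d → BinState) (x : Context d) : Bin d :=
  binOf (sInf {k : ℕ | ¬ (st (binOf k x)).split}) x

open Classical in
/-- The states of all the bins after the given observations (most recent first). -/
noncomputable def states (d : ℕ) (b c₀ : ℝ) (T : ℕ) : List (Observation d) → Bin d → BinState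
  | [] => fun _ => BinState.init
  | (x, a, y) :: h =>
    let st := states d b c₀ T h
    let B := liveBin st x
    Function.update st B (((st B).record a y).endRound d b c₀ T B.1)

end ABSE

/-- The policy `ABSE(b)` with horizon `T`, tuned for the smoothness exponent `b`, with tuning
constant `c₀`: follow the successive elimination policy of the live bin containing the context. -/
noncomputable def abse (d : ℕ) (b c₀ : ℝ) (T : ℕ) : Policy d := fun h x =>
  let st := ABSE.states d b c₀ T h
  (st (ABSE.liveBin st x)).nextArm

/-!
The regret of `ABSE(b)` is bounded below by exhibiting, for each of the two regimes, a problem with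
uniform contexts whose payoff functions are truncated tents in the sup-norm distance to the origin
(`ABSE.exists_tent_problem`). Only first moments of the observed rewards are needed. Throughout, the
bins containing a fixed context form a chain, and the sequence of states of one of these bins is
a deterministic function of the rewards received in it (`ABSE.IsBinRun`). The state of the bins is
determined by the past, hence independent of the context and rewards of the current period
(`ABSE.integral_past_mul`), which evaluates all the expectations that occur.

*Oversmoothing, `β < b`.* At depth `k` the payoffs of a smooth problem can differ on average by an
amount `D` of the order of `2 ^ (-kβ)`, while a bin is split only if its average rewards differ by
at most a multiple of `2 ^ (-kb)` after `ℓ_B` rounds. Choose `k`, independent of the horizon, such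
that the first exceeds the second, with arm `0` better on average in the bin at the origin although
arm `1` is better in a part of it. The expected difference of the rewards collected in the bin would
be too large if the bin were split with a probability close to one, so the bin stays unsplit with
a probability of at least `D / 3` (`ABSE.le_prob_not_split`). As long as it is not split, the same
arm is used on the whole bin, and this is wrong on a set of positive measure: the regret is linear.

*Undersmoothing, `b < β`.* The policy refines its partition down to bins of side `H`, with
`T H ^ (2b + d)` of order one, so that a gap `Δ` of the order of `H ^ b` cannot be detected in any
bin. Let arm `0` have payoff `Δ` on a cube of volume of the order of `Δ ^ α`, and arm `1` payoff
`0`. An elimination in round `τ` needs the rewards collected in the bin to exceed `2 τ U(τ)`. With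
the reward of the `v`-th visit weighted by `1/√v`, each of these conditions makes one and the same
weighted sum large (`ABSE.IsBinRun.le_of_active_ne`), and Markov's inequality bounds the probability of
an elimination by a multiple of `Δ √N` for `N` visits (`ABSE.prob_elimEvent_mul_le`). These bounds
form a geometric sum over the chain of bins, of the order of `Δ / H ^ b`. When both arms survive they
alternate, so the inferior arm is pulled in a fixed fraction of the periods
(`ABSE.le_sum_prob_pullEvent`), and the regret is of the order of `T Δ ^ (1 + α)`. The argument does
not need `b < β`.

The margin condition with an arbitrarily small `C₀` is met because the volume of the support is at
most of the order of `Δ ^ α`, and that of the layers where the tent has not reached its height is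
controlled by `α ≤ 1/β`. A plateau of this volume has room for the layers if `Δ ^ (1/β)` is small
compared with `Δ ^ (α/d)`: this is where `α β < d`, or a large `C₀`, is used.
-/

/-! ### Dyadic bins and their volume -/

namespace ABSE

theorem min_floor_two_pow_div {i j : ℕ} (hij : i ≤ j) (u : ℝ) :
    min ⌊2 ^ j * u⌋₊ (2 ^ j - 1) / 2 ^ (j - i) = min ⌊2 ^ i * u⌋₊ (2 ^ i - 1) := by
  have hmono : Monotone fun n : ℕ => n / 2 ^ (j - i) := fun a b h => Nat.div_le_div_right h
  have h1 : ⌊2 ^ j * u⌋₊ / 2 ^ (j - i) = ⌊2 ^ i * u⌋₊ := by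
    have h := Nat.floor_div_natCast ((2 : ℝ) ^ j * u) (2 ^ (j - i))
    rw [← h]
    congr 1
    push_cast
    rw [← pow_sub_mul_pow (2 : ℝ) hij]
    field_simp
  have h2 : (2 ^ j - 1) / 2 ^ (j - i) = 2 ^ i - 1 := by
    have hp : 0 < 2 ^ (j - i) := by positivity
    have hj : 2 ^ j = 2 ^ (j - i) * 2 ^ i := (pow_sub_mul_pow 2 hij).symm
    rw [hj, Nat.mul_sub_div _ _ _ (by positivity)]
    simp
  have h3 := hmono.map_min (a := ⌊2 ^ j * u⌋₊) (b := 2 ^ j - 1)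
  simp only [h1, h2] at h3
  exact h3

/-- Dyadic partitions are nested. -/
theorem binOf_eq_of_le {d : ℕ} {i j : ℕ} (hij : i ≤ j) {x y : Context d}
    (h : binOf j x = binOf j y) : binOf i x = binOf i y := by
  simp only [binOf, Prod.mk.injEq, true_and] at h ⊢
  funext a
  have := congrFun h a
  rw [← min_floor_two_pow_div hij, ← min_floor_two_pow_div hij, this]

theorem measurable_binOf {d : ℕ} (k : ℕ) : Measurable (binOf k : Context d → Bin d) := by
  unfold binOf
  refine measurable_const.prodMk (measurable_pi_lambda _ fun i => ?_)
  refine Measurable.min (Nat.measurable_floor.comp ?_) measurable_const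
  exact measurable_const.mul (measurable_subtype_coe.comp (measurable_pi_apply i))

/-- The contexts lying in the same dyadic cell of depth `k` as `x`. -/
def cell {d : ℕ} (k : ℕ) (x : Context d) : Set (Context d) := {y | binOf k y = binOf k x}

theorem measurableSet_cell {d : ℕ} (k : ℕ) (x : Context d) : MeasurableSet (cell k x) :=
  measurable_binOf k (measurableSet_singleton (binOf k x))

theorem volume_floor_eq (k m : ℕ) (hm : m ≤ 2 ^ k - 1) :
    volume {u : unitInterval | min ⌊2 ^ k * (u : ℝ)⌋₊ (2 ^ k - 1) = m}
      = ENNReal.ofReal ((2 : ℝ)⁻¹ ^ k) := by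
  have hp : (0 : ℝ) < 2 ^ k := by positivity
  have hp1 : 1 ≤ 2 ^ k := Nat.one_le_two_pow
  have hm' : ((m : ℝ) + 1) ≤ 2 ^ k := by
    have : m + 1 ≤ 2 ^ k := by omega
    exact_mod_cast this
  have ha : (m : ℝ) / 2 ^ k ∈ unitInterval :=
    ⟨by positivity, by rw [div_le_one hp]; linarith⟩
  have hb : ((m : ℝ) + 1) / 2 ^ k ∈ unitInterval :=
    ⟨by positivity, by rw [div_le_one hp]; linarith⟩
  rcases hm.lt_or_eq with h | h
  · have : {u : unitInterval | min ⌊2 ^ k * (u : ℝ)⌋₊ (2 ^ k - 1) = m}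
        = Set.Ico ⟨_, ha⟩ ⟨_, hb⟩ := by
      ext u
      have hu : 0 ≤ 2 ^ k * (u : ℝ) := mul_nonneg hp.le u.2.1
      have e : (min ⌊2 ^ k * (u : ℝ)⌋₊ (2 ^ k - 1) = m) ↔ ⌊2 ^ k * (u : ℝ)⌋₊ = m := by omega
      simp only [Set.mem_ofPred_eq, e, Nat.floor_eq_iff hu, Set.mem_Ico, ← Subtype.coe_le_coe,
        ← Subtype.coe_lt_coe]
      rw [div_le_iff₀ hp, lt_div_iff₀ hp, mul_comm (u : ℝ)]
    rw [this, unitInterval.volume_Ico]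
    congr 1
    simp only [inv_pow]
    field_simp
    ring
  · have : {u : unitInterval | min ⌊2 ^ k * (u : ℝ)⌋₊ (2 ^ k - 1) = m}
        = Set.Icc ⟨_, ha⟩ ⟨_, hb⟩ := by
      ext u
      have hu : 0 ≤ 2 ^ k * (u : ℝ) := mul_nonneg hp.le u.2.1
      have e : (min ⌊2 ^ k * (u : ℝ)⌋₊ (2 ^ k - 1) = m) ↔ m ≤ ⌊2 ^ k * (u : ℝ)⌋₊ := by omega
      have e2 : ((m : ℝ) + 1) = 2 ^ k := by
        have : m + 1 = 2 ^ k := by omega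
        exact_mod_cast this
      simp only [Set.mem_ofPred_eq, e, Nat.le_floor_iff hu, Set.mem_Icc, ← Subtype.coe_le_coe]
      rw [div_le_iff₀ hp, mul_comm (u : ℝ), e2, div_self hp.ne']
      simp [u.2.2]
    rw [this, unitInterval.volume_Icc]
    congr 1
    simp only [inv_pow]
    field_simp
    ring

theorem volume_cell {d : ℕ} (k : ℕ) (x : Context d) :
    (volume : Measure (Context d)).real (cell k x) = ((2 : ℝ)⁻¹ ^ k) ^ d := by
  have : cell k x = Set.pi Set.univ fun i => {u : unitInterval |
      min ⌊2 ^ k * (u : ℝ)⌋₊ (2 ^ k - 1) = (binOf k x).2 i} := by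
    ext y
    simp [cell, binOf, funext_iff, Set.mem_pi]
  rw [measureReal_def, this, volume_pi_pi]
  have h : ∀ i, volume {u : unitInterval |
      min ⌊2 ^ k * (u : ℝ)⌋₊ (2 ^ k - 1) = (binOf k x).2 i} = ENNReal.ofReal ((2 : ℝ)⁻¹ ^ k) :=
    fun i => volume_floor_eq k _ (min_le_right _ _)
  simp only [h, Finset.prod_const, Finset.card_univ, Fintype.card_fin]
  rw [← ENNReal.ofReal_pow (by positivity), ENNReal.toReal_ofReal (by positivity)]

/-- The lower corner of the cell of depth `k` with integer coordinates `v`. -/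
noncomputable def corner {d : ℕ} (k : ℕ) (v : Fin d → Fin (2 ^ k)) : Context d := fun i =>
  ⟨(v i : ℝ) / 2 ^ k, by positivity, by
    rw [div_le_one (by positivity)]
    exact_mod_cast (v i).2.le⟩

theorem binOf_corner {d : ℕ} (k : ℕ) (v : Fin d → Fin (2 ^ k)) :
    binOf k (corner k v) = (k, fun i => (v i : ℕ)) := by
  simp only [binOf, corner, Prod.mk.injEq, true_and]
  funext i
  rw [mul_div_cancel₀ _ (by positivity), Nat.floor_natCast]
  have := (v i).2
  omega

/-- The cells of the corners of depth `k` partition the cube. -/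
theorem existsUnique_mem_cell_corner {d : ℕ} (k : ℕ) (x : Context d) :
    ∃! v : Fin d → Fin (2 ^ k), x ∈ cell k (corner k v) := by
  have hp : 1 ≤ 2 ^ k := Nat.one_le_two_pow
  refine ⟨fun i => ⟨(binOf k x).2 i, ?_⟩, ?_, fun w hw => ?_⟩
  · have : (binOf k x).2 i ≤ 2 ^ k - 1 := min_le_right _ _
    omega
  · simp only [cell, Set.mem_ofPred_eq, binOf_corner]
    rfl
  · simp only [cell, Set.mem_ofPred_eq, binOf_corner] at hw
    funext i
    ext
    simp [hw]

theorem volume_dist_zero_le {d : ℕ} {a : ℝ} (h0 : 0 ≤ a) (h1 : a ≤ 1) :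
    (volume : Measure (Context d)).real {x | dist x 0 ≤ a} = a ^ d := by
  have : {x : Context d | dist x 0 ≤ a}
      = Set.pi Set.univ fun _ => Set.Iic (⟨a, h0, h1⟩ : unitInterval) := by
    ext x
    simp only [Set.mem_ofPred_eq, dist_pi_le_iff h0, Set.mem_pi, Set.mem_univ, true_imp_iff,
      Set.mem_Iic, ← Subtype.coe_le_coe]
    refine forall_congr' fun i => ?_
    rw [Subtype.dist_eq, Real.dist_eq]
    simp [abs_of_nonneg (x i).2.1]
  rw [measureReal_def, this, volume_pi_pi]
  simp only [unitInterval.volume_Iic, Finset.prod_const, Finset.card_univ, Fintype.card_fin]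
  rw [← ENNReal.ofReal_pow h0, ENNReal.toReal_ofReal (by positivity)]

theorem mem_cell_zero_of_dist_lt {d : ℕ} {k : ℕ} {x : Context d} (h : dist x 0 < (2 : ℝ)⁻¹ ^ k) :
    x ∈ cell k (0 : Context d) := by
  simp only [cell, binOf, Set.mem_ofPred_eq, Prod.mk.injEq, true_and]
  funext i
  have hi : (x i : ℝ) < (2 : ℝ)⁻¹ ^ k := by
    refine lt_of_le_of_lt ?_ h
    have := dist_le_pi_dist x 0 i
    rw [Subtype.dist_eq, Real.dist_eq] at this
    simpa [abs_of_nonneg (x i).2.1] using this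
  have : 2 ^ k * (x i : ℝ) < 1 := by
    rw [inv_pow, ← one_div, lt_div_iff₀ (by positivity)] at hi
    linarith
  simp [Nat.floor_eq_zero.2 this]

end ABSE

/-! ### Confidence radii and the round cap -/

namespace ABSE

theorem radius_mul_sqrt {τ : ℕ} (hτ : 1 ≤ τ) (S : ℝ) :
    radius τ S * √τ = 2 * √(2 * max (Real.log (S / τ)) 1) := by
  have h : (0 : ℝ) < τ := by exact_mod_cast hτ
  rw [radius, Real.sqrt_div' _ h.le]
  have := Real.sqrt_pos.2 h
  field_simp

theorem one_le_radius_mul_sqrt {τ : ℕ} (hτ : 1 ≤ τ) (S : ℝ) : 2 ≤ radius τ S * √τ := by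
  rw [radius_mul_sqrt hτ]
  have : (1 : ℝ) ≤ √(2 * max (Real.log (S / τ)) 1) := by
    rw [Real.one_le_sqrt]
    have := le_max_right (Real.log (S / τ)) 1
    linarith
  linarith

theorem log_div_anti {S : ℝ} (hS : 0 ≤ S) {p n : ℝ} (hp : 0 < p) (hpn : p ≤ n) :
    Real.log (S / n) ≤ Real.log (S / p) := by
  rcases hS.eq_or_lt with rfl | hS
  · simp
  · have : 0 < n := hp.trans_le hpn
    exact Real.log_le_log (by positivity) (by gcongr)

theorem radius_mul_sqrt_anti {S : ℝ} (hS : 0 ≤ S) {p n : ℕ} (hp : 1 ≤ p) (hpn : p ≤ n) :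
    radius n S * √n ≤ radius p S * √p := by
  rw [radius_mul_sqrt hp, radius_mul_sqrt (hp.trans hpn)]
  have := log_div_anti hS (p := p) (n := n) (by exact_mod_cast hp) (by exact_mod_cast hpn)
  gcongr

/-- Doubling the number of rounds (or less) divides the radius by at most `4`. -/
theorem radius_le_four_mul {S : ℝ} (hS : 0 ≤ S) {p n : ℕ} (hp : 1 ≤ p) (hpn : p ≤ n)
    (hn : n ≤ 2 * p) : radius p S ≤ 4 * radius n S := by
  have hp0 : (0 : ℝ) < p := by exact_mod_cast hp
  have hn0 : (0 : ℝ) < n := by exact_mod_cast (hp.trans hpn)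
  have hn' : (n : ℝ) ≤ 2 * p := by exact_mod_cast hn
  have hlog : Real.log (S / p) ≤ Real.log (S / n) + Real.log 2 := by
    rcases hS.eq_or_lt with rfl | hS
    · simp only [zero_div, Real.log_zero, zero_add]; exact Real.log_nonneg one_le_two
    · rw [← Real.log_mul (by positivity) (by norm_num)]
      refine Real.log_le_log (by positivity) ?_
      rw [div_mul_eq_mul_div, div_le_div_iff₀ hp0 hn0]
      nlinarith
  have h2 : Real.log 2 ≤ 1 := by have := Real.log_two_lt_d9; linarith
  have hm : max (Real.log (S / p)) 1 ≤ 2 * max (Real.log (S / n)) 1 := by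
    have a := le_max_left (Real.log (S / n)) 1
    have b := le_max_right (Real.log (S / n)) 1
    refine max_le ?_ ?_ <;> linarith
  have key : √(2 * max (Real.log (S / p)) 1 / p) ≤ √(4 ^ 2 * (2 * max (Real.log (S / n)) 1 / n)) := by
    refine Real.sqrt_le_sqrt ?_
    have hM : 0 ≤ max (Real.log (S / n)) 1 := le_max_of_le_right zero_le_one
    rw [mul_div_assoc', div_le_div_iff₀ hp0 hn0]
    nlinarith [mul_le_mul hm hn' hn0.le (by positivity)]
  rw [Real.sqrt_mul (by positivity), Real.sqrt_sq (by norm_num)] at key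
  unfold radius
  linarith

theorem localHorizon_nonneg (d T k : ℕ) : 0 ≤ localHorizon d T k := by
  unfold localHorizon; positivity

theorem tendsto_radius (S : ℝ) :
    Filter.Tendsto (fun l : ℕ => radius l S) Filter.atTop (nhds 0) := by
  have h1 : Filter.Tendsto (fun l : ℕ => 2 * √(2 / (l : ℝ))) Filter.atTop (nhds 0) := by
    have := (Real.continuous_sqrt.tendsto 0).comp (tendsto_const_div_atTop_nhds_zero_nat 2)
    simpa using this.const_mul 2
  refine h1.congr' ?_
  filter_upwards [Filter.eventually_ge_atTop (⌈|S|⌉₊ + 1)] with l hl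
  have hl0 : (0 : ℝ) < l := by exact_mod_cast (by omega : 0 < l)
  have hS : |S| ≤ l := (Nat.le_ceil _).trans (by exact_mod_cast (by omega : ⌈|S|⌉₊ ≤ l))
  have : Real.log (S / l) ≤ 0 := by
    rw [← Real.log_abs]
    refine Real.log_nonpos (abs_nonneg _) ?_
    rw [abs_div, abs_of_pos hl0, div_le_one hl0]
    exact hS
  rw [radius, max_eq_right (by linarith), mul_one]

section Cap

variable {d : ℕ} {b c₀ : ℝ} {T k : ℕ}

theorem maxRounds_spec (hc : 0 < c₀) : 1 ≤ maxRounds d b c₀ T k ∧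
    radius (maxRounds d b c₀ T k) (localHorizon d T k) ≤ 2 * c₀ * ((2 : ℝ)⁻¹ ^ k) ^ b := by
  have hpos : 0 < 2 * c₀ * ((2 : ℝ)⁻¹ ^ k) ^ b := by positivity
  have h1 := (tendsto_radius (localHorizon d T k)).eventually (ge_mem_nhds hpos)
  obtain ⟨l, hl1, hl2⟩ := ((Filter.eventually_ge_atTop 1).and h1).exists
  exact Nat.sInf_mem (s := {l : ℕ | 1 ≤ l ∧
    radius l (localHorizon d T k) ≤ 2 * c₀ * ((2 : ℝ)⁻¹ ^ k) ^ b}) ⟨l, hl1, hl2⟩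

/-- The radius at which a bin is split is not much smaller than the prescribed level. -/
theorem le_radius_maxRounds (hc : 0 < c₀) :
    min 1 (c₀ / 2 * ((2 : ℝ)⁻¹ ^ k) ^ b)
      ≤ radius (maxRounds d b c₀ T k) (localHorizon d T k) := by
  obtain ⟨h1, -⟩ := maxRounds_spec (d := d) (b := b) (T := T) (k := k) hc
  rcases h1.eq_or_lt with h | h
  · refine (min_le_left _ _).trans ?_
    have := one_le_radius_mul_sqrt h1 (localHorizon d T k)
    rw [← h] at this ⊢
    simp only [Nat.cast_one, Real.sqrt_one, mul_one] at this
    linarith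
  · refine (min_le_right _ _).trans ?_
    have hn : ¬ radius (maxRounds d b c₀ T k - 1) (localHorizon d T k)
        ≤ 2 * c₀ * ((2 : ℝ)⁻¹ ^ k) ^ b := fun hcon => by
      have : maxRounds d b c₀ T k ≤ maxRounds d b c₀ T k - 1 :=
        Nat.sInf_le (s := {l : ℕ | 1 ≤ l ∧
          radius l (localHorizon d T k) ≤ 2 * c₀ * ((2 : ℝ)⁻¹ ^ k) ^ b}) ⟨by omega, hcon⟩
      omega
    have h4 := radius_le_four_mul (localHorizon_nonneg d T k)
      (p := maxRounds d b c₀ T k - 1) (n := maxRounds d b c₀ T k) (by omega) (by omega) (by omega)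
    push Not at hn
    linarith

/-! ### The run of successive elimination in one bin -/

/-- The state of a bin of depth `k` after a pull of the next arm with reward `y`. -/
noncomputable def BinState.step (d : ℕ) (b c₀ : ℝ) (T k : ℕ) (s : BinState) (y : Bool) :
    BinState :=
  (s.record s.nextArm y).endRound d b c₀ T k

/-- The sequence of states of a bin of depth `k` which is visited in the periods `t` with `c t`;
`y t` is the reward received in period `t`. -/
structure IsBinRun (d : ℕ) (b c₀ : ℝ) (T k : ℕ) (s : ℕ → BinState) (c : ℕ → Prop)
    (y : ℕ → Bool) : Prop where
  zero : s 0 = BinState.init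
  succ_of_visit : ∀ t, c t → s (t + 1) = (s t).step d b c₀ T k (y t)
  succ_of_not_visit : ∀ t, ¬ c t → s (t + 1) = s t
  not_split : ∀ t, c t → ¬ (s t).split

/-- The reward `0` or `1` as a real number. -/
def rewardValue (y : Bool) : ℝ := if y then 1 else 0

theorem rewardValue_nonneg (y : Bool) : 0 ≤ rewardValue y := by unfold rewardValue; split <;> simp

theorem rewardValue_le_one (y : Bool) : rewardValue y ≤ 1 := by unfold rewardValue; split <;> simp

open Classical in
/-- The sum of the weights `w t` over the periods `t < n` in which the bin is visited while both
arms are active and arm `i` is pulled. -/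
noncomputable def armSum (s : ℕ → BinState) (c : ℕ → Prop) (i : Arm) (w : ℕ → ℝ) (n : ℕ) : ℝ :=
  ∑ t ∈ Finset.range n,
    if c t ∧ (s t).active = Finset.univ ∧ (s t).nextArm = i then w t else 0

/-- The invariants of the states of a bin of depth `k`: while both arms are active they alternate,
an unsplit bin above the maximal depth has completed fewer than `ℓ_B` rounds, and a bin is split
after exactly `ℓ_B` rounds, having passed the elimination test. -/
structure BinState.Valid (d : ℕ) (b c₀ : ℝ) (T k : ℕ) (s : BinState) : Prop where
  alternate : s.active = Finset.univ → s.pulls 0 = s.pulls 1 ∨ s.pulls 0 = s.pulls 1 + 1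
  cap : s.active = Finset.univ → ¬ s.split → k < maxDepth d b T →
    s.pulls 1 < maxRounds d b c₀ T k
  of_split : s.split → s.active = Finset.univ ∧ k < maxDepth d b T ∧
    s.pulls 0 = maxRounds d b c₀ T k ∧ s.pulls 1 = maxRounds d b c₀ T k ∧
    s.mean 0 - 2 * radius (maxRounds d b c₀ T k) (localHorizon d T k) ≤ s.mean 1

theorem BinState.valid_init (hc : 0 < c₀) : BinState.init.Valid d b c₀ T k where
  alternate _ := Or.inl rfl
  cap _ _ _ := (maxRounds_spec hc).1
  of_split h := absurd h id

theorem BinState.nextArm_of_eq {s : BinState} (ha : s.active = Finset.univ)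
    (h : s.pulls 0 = s.pulls 1) : s.nextArm = 0 := by
  simp [nextArm, ha, h]

theorem BinState.nextArm_of_eq_add_one {s : BinState} (ha : s.active = Finset.univ)
    (h : s.pulls 0 = s.pulls 1 + 1) : s.nextArm = 1 := by
  simp [nextArm, ha, h]

theorem BinState.step_of_active_ne {s : BinState} (ha : s.active ≠ Finset.univ) (y : Bool) :
    (s.step d b c₀ T k y).active = s.active ∧ (s.step d b c₀ T k y).split = s.split := by
  have : ¬ ((s.record s.nextArm y).active = Finset.univ ∧
    (s.record s.nextArm y).pulls 0 = (s.record s.nextArm y).pulls 1) := fun h => ha h.1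
  rw [step, endRound, if_neg this]
  exact ⟨rfl, rfl⟩

/-- The first pull of a round. -/
theorem BinState.step_first {s : BinState} (ha : s.active = Finset.univ)
    (h : s.pulls 0 = s.pulls 1) (y : Bool) :
    let s' := s.step d b c₀ T k y
    s'.active = Finset.univ ∧ s'.split = s.split ∧ s'.pulls 0 = s.pulls 0 + 1 ∧
      s'.pulls 1 = s.pulls 1 ∧ (s'.total 0 : ℝ) = s.total 0 + rewardValue y ∧
      s'.total 1 = s.total 1 := by
  have : ¬ ((s.record s.nextArm y).active = Finset.univ ∧
      (s.record s.nextArm y).pulls 0 = (s.record s.nextArm y).pulls 1) := by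
    rw [nextArm_of_eq ha h]
    simp [record, h]
  rw [step, endRound, if_neg this, nextArm_of_eq ha h]
  cases y <;> simp [record, ha, rewardValue]

/-- The second pull of a round, with the elimination test at its end. -/
theorem BinState.step_second {s : BinState} (ha : s.active = Finset.univ)
    (h : s.pulls 0 = s.pulls 1 + 1) (y : Bool) :
    let s' := s.step d b c₀ T k y
    s'.pulls 0 = s.pulls 0 ∧ s'.pulls 1 = s.pulls 0 ∧ s'.total 0 = s.total 0 ∧
      (s'.total 1 : ℝ) = s.total 1 + rewardValue y ∧
      (s'.active = Finset.univ ↔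
        ∀ i j, s'.mean j - 2 * radius (s.pulls 0) (localHorizon d T k) ≤ s'.mean i) ∧
      (s'.split ↔ s'.active = Finset.univ ∧ maxRounds d b c₀ T k ≤ s.pulls 0 ∧
        k < maxDepth d b T) := by
  have h0 : (s.record 1 y).pulls 0 = s.pulls 0 := by simp [record]
  have h1 : (s.record 1 y).pulls 1 = s.pulls 0 := by simp [record, h]
  have : (s.record s.nextArm y).active = Finset.univ ∧
      (s.record s.nextArm y).pulls 0 = (s.record s.nextArm y).pulls 1 := by
    rw [nextArm_of_eq_add_one ha h]
    exact ⟨ha, by rw [h0, h1]⟩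
  rw [step, endRound, if_pos this, nextArm_of_eq_add_one ha h]
  refine ⟨h0, h1, by simp [record], by cases y <;> simp [record, rewardValue], ?_, ?_⟩
  · simp only [Finset.filter_eq_self, Finset.mem_univ, true_imp_iff, h0]
    rfl
  · simp only [h0]

end Cap

section Run

variable {d : ℕ} {b c₀ : ℝ} {T k : ℕ} {s : ℕ → BinState} {c : ℕ → Prop} {y : ℕ → Bool}

open Classical in
theorem armSum_succ (i : Arm) (w : ℕ → ℝ) (n : ℕ) :
    armSum s c i w (n + 1) = armSum s c i w n +
      if c n ∧ (s n).active = Finset.univ ∧ (s n).nextArm = i then w n else 0 :=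
  Finset.sum_range_succ _ _

theorem armSum_zero (i : Arm) (w : ℕ → ℝ) : armSum s c i w 0 = 0 := Finset.sum_range_zero _

theorem armSum_mono_weight (i : Arm) {w w' : ℕ → ℝ} (h : ∀ t, w t ≤ w' t) (n : ℕ) :
    armSum s c i w n ≤ armSum s c i w' n := by
  refine Finset.sum_le_sum fun t _ => ?_
  split_ifs
  exacts [h t, le_rfl]

theorem armSum_nonneg (i : Arm) {w : ℕ → ℝ} (h : ∀ t, 0 ≤ w t) (n : ℕ) :
    0 ≤ armSum s c i w n := by
  refine Finset.sum_nonneg fun t _ => ?_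
  split_ifs
  exacts [h t, le_rfl]

/-- The possible transitions in one period: nothing relevant happens, a round is started, or a
round is completed. -/
theorem IsBinRun.trichotomy (hr : IsBinRun d b c₀ T k s c y)
    (hv : ∀ n, (s n).active = Finset.univ →
      (s n).pulls 0 = (s n).pulls 1 ∨ (s n).pulls 0 = (s n).pulls 1 + 1) (n : ℕ) :
    (s (n + 1) = s n ∧ ∀ i w, armSum s c i w (n + 1) = armSum s c i w n) ∨
    ((s n).active ≠ Finset.univ ∧ (s (n + 1)).active = (s n).active ∧
      (s (n + 1)).split = (s n).split ∧ ∀ i w, armSum s c i w (n + 1) = armSum s c i w n) ∨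
    ((s n).active = Finset.univ ∧ ¬ (s n).split ∧ (s n).pulls 0 = (s n).pulls 1 ∧
      s (n + 1) = (s n).step d b c₀ T k (y n) ∧
      (∀ w, armSum s c 0 w (n + 1) = armSum s c 0 w n + w n) ∧
      ∀ w, armSum s c 1 w (n + 1) = armSum s c 1 w n) ∨
    ((s n).active = Finset.univ ∧ ¬ (s n).split ∧ (s n).pulls 0 = (s n).pulls 1 + 1 ∧
      s (n + 1) = (s n).step d b c₀ T k (y n) ∧
      (∀ w, armSum s c 0 w (n + 1) = armSum s c 0 w n) ∧
      ∀ w, armSum s c 1 w (n + 1) = armSum s c 1 w n + w n) := by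
  by_cases hc : c n
  · by_cases ha : (s n).active = Finset.univ
    · rcases hv n ha with h | h
      · right; right; left
        refine ⟨ha, hr.not_split n hc, h, hr.succ_of_visit n hc, fun w => ?_, fun w => ?_⟩ <;>
          simp [armSum_succ, hc, ha, BinState.nextArm_of_eq ha h]
      · right; right; right
        refine ⟨ha, hr.not_split n hc, h, hr.succ_of_visit n hc, fun w => ?_, fun w => ?_⟩ <;>
          simp [armSum_succ, hc, ha, BinState.nextArm_of_eq_add_one ha h]
    · right; left
      rw [hr.succ_of_visit n hc]
      exact ⟨ha, (BinState.step_of_active_ne ha _).1, (BinState.step_of_active_ne ha _).2,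
        fun i w => by simp [armSum_succ, ha]⟩
  · left
    exact ⟨hr.succ_of_not_visit n hc, fun i w => by simp [armSum_succ, hc]⟩

theorem BinState.valid_step {s : BinState} (hs : s.Valid d b c₀ T k)
    (hns : ¬ s.split) (y : Bool) : (s.step d b c₀ T k y).Valid d b c₀ T k := by
  by_cases ha : s.active = Finset.univ
  · rcases hs.alternate ha with h | h
    · obtain ⟨h1, h2, h3, h4, -, -⟩ := step_first (d := d) (b := b) (c₀ := c₀) (T := T) (k := k)
        ha h y
      refine ⟨fun _ => Or.inr (by omega), fun _ _ hk => ?_, fun hsp => ?_⟩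
      · rw [h4]; exact hs.cap ha hns hk
      · rw [h2] at hsp; exact absurd hsp hns
    · obtain ⟨h1, h2, -, -, h5, h6⟩ := step_second (d := d) (b := b) (c₀ := c₀) (T := T) (k := k)
        ha h y
      refine ⟨fun _ => Or.inl (by omega), fun ha' hs' hk => ?_, fun hsp => ?_⟩
      · by_contra hcon
        exact hs' (h6.2 ⟨ha', by omega, hk⟩)
      · obtain ⟨ha', hl, hk⟩ := h6.1 hsp
        have := hs.cap ha hns hk
        have hl' : s.pulls 0 = maxRounds d b c₀ T k := by omega
        refine ⟨ha', hk, by omega, by omega, ?_⟩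
        rw [← hl']
        exact h5.1 ha' 1 0
  · obtain ⟨h1, h2⟩ := step_of_active_ne (d := d) (b := b) (c₀ := c₀) (T := T) (k := k) ha y
    refine ⟨fun h => absurd (h1 ▸ h) ha, fun h => absurd (h1 ▸ h) ha, fun h => ?_⟩
    rw [h2] at h
    exact absurd h hns

theorem IsBinRun.valid (hc : 0 < c₀) (hr : IsBinRun d b c₀ T k s c y) (n : ℕ) :
    (s n).Valid d b c₀ T k := by
  induction n with
  | zero => rw [hr.zero]; exact BinState.valid_init hc
  | succ n ih =>
    by_cases h : c n
    · rw [hr.succ_of_visit n h]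
      exact BinState.valid_step ih (hr.not_split n h) _
    · rw [hr.succ_of_not_visit n h]; exact ih

/-- While both arms are active the sums over the run are the counters of the state. After an
elimination, both arms have been pulled equally often before it. -/
theorem IsBinRun.armSum_eq (hc : 0 < c₀) (hr : IsBinRun d b c₀ T k s c y) (n : ℕ) :
    ((s n).active = Finset.univ → armSum s c 0 (fun _ => 1) n = (s n).pulls 0 ∧
      armSum s c 1 (fun _ => 1) n = (s n).pulls 1 ∧
      armSum s c 0 (fun t => rewardValue (y t)) n = (s n).total 0 ∧
      armSum s c 1 (fun t => rewardValue (y t)) n = (s n).total 1) ∧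
    ((s n).active ≠ Finset.univ → ¬ (s n).split ∧
      armSum s c 0 (fun _ => 1) n = armSum s c 1 (fun _ => 1) n ∧
      (k < maxDepth d b T → armSum s c 0 (fun _ => 1) n ≤ maxRounds d b c₀ T k)) := by
  have hv := hr.valid hc
  induction n with
  | zero =>
    rw [hr.zero]
    simp [BinState.init, armSum_zero]
  | succ n ih =>
    rcases hr.trichotomy (fun n => (hv n).alternate) n with
      ⟨h1, h2⟩ | ⟨ha, h1, h2, h3⟩ | ⟨ha, hns, hp, hst, h0, h1⟩ | ⟨ha, hns, hp, hst, h0, h1⟩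
    · rw [h1]; simp only [h2]; exact ih
    · simp only [h1, h2, h3]
      exact ⟨fun h => absurd h ha, ih.2⟩
    · obtain ⟨e1, e2, e3, e4, e5, e6⟩ := BinState.step_first (d := d) (b := b) (c₀ := c₀) (T := T)
        (k := k) ha hp (y n)
      obtain ⟨g1, g2, g3, g4⟩ := ih.1 ha
      rw [hst]
      refine ⟨fun _ => ?_, fun h => absurd e1 h⟩
      simp only [h0, h1, g1, g2, g3, g4, e3, e4, e5, e6]
      simp
    · obtain ⟨e1, e2, e3, e4, e5, e6⟩ := BinState.step_second (d := d) (b := b) (c₀ := c₀) (T := T)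
        (k := k) ha hp (y n)
      obtain ⟨g1, g2, g3, g4⟩ := ih.1 ha
      rw [hst]
      refine ⟨fun _ => ?_, fun h => ⟨fun hs => h (e6.1 hs).1, ?_, fun hk => ?_⟩⟩
      · simp only [h0, h1, g1, g2, g3, g4, e1, e2, e3, e4, hp]
        simp
      · simp only [h0, h1, g1, g2, hp]
        simp
      · rw [h0, g1, hp]
        have := (hv n).cap ha hns hk
        exact_mod_cast this

theorem IsBinRun.armSum_zero_le_add_one (hc : 0 < c₀) (hr : IsBinRun d b c₀ T k s c y) (n : ℕ) :
    armSum s c 0 (fun _ => 1) n ≤ armSum s c 1 (fun _ => 1) n + 1 := by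
  obtain ⟨h1, h2⟩ := hr.armSum_eq hc n
  by_cases ha : (s n).active = Finset.univ
  · obtain ⟨g1, g2, -, -⟩ := h1 ha
    rw [g1, g2]
    rcases (hr.valid hc n).alternate ha with h | h <;> simp [h]
  · rw [(h2 ha).2.1]; linarith

theorem IsBinRun.armSum_one_le_armSum_zero (hc : 0 < c₀) (hr : IsBinRun d b c₀ T k s c y)
    (n : ℕ) : armSum s c 1 (fun _ => 1) n ≤ armSum s c 0 (fun _ => 1) n := by
  obtain ⟨h1, h2⟩ := hr.armSum_eq hc n
  by_cases ha : (s n).active = Finset.univ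
  · obtain ⟨g1, g2, -, -⟩ := h1 ha
    rw [g1, g2]
    rcases (hr.valid hc n).alternate ha with h | h <;> simp [h]
  · rw [(h2 ha).2.1]

/-- Below the maximal depth, each arm is pulled at most `ℓ_B` times while both are active. -/
theorem IsBinRun.armSum_le_maxRounds (hc : 0 < c₀) (hr : IsBinRun d b c₀ T k s c y)
    (hk : k < maxDepth d b T) (n : ℕ) :
    armSum s c 0 (fun _ => 1) n ≤ maxRounds d b c₀ T k := by
  obtain ⟨h1, h2⟩ := hr.armSum_eq hc n
  have hv := hr.valid hc n
  by_cases ha : (s n).active = Finset.univ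
  · rw [(h1 ha).1]
    by_cases hs : (s n).split
    · exact_mod_cast (hv.of_split hs).2.2.1.le
    · have := hv.cap ha hs hk
      have : (s n).pulls 0 ≤ maxRounds d b c₀ T k := by
        rcases hv.alternate ha with h | h <;> omega
      exact_mod_cast this
  · exact (h2 ha).2.2 hk

/-- If the bin has been split, then the difference of the collected rewards is within the
elimination threshold. -/
theorem IsBinRun.of_split (hc : 0 < c₀) (hr : IsBinRun d b c₀ T k s c y) {n : ℕ}
    (hs : (s n).split) :
    armSum s c 1 (fun _ => 1) n = maxRounds d b c₀ T k ∧
    armSum s c 0 (fun t => rewardValue (y t)) n - armSum s c 1 (fun t => rewardValue (y t)) n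
      ≤ 4 * c₀ * ((2 : ℝ)⁻¹ ^ k) ^ b * maxRounds d b c₀ T k := by
  obtain ⟨ha, hk, hp0, hp1, hm⟩ := (hr.valid hc n).of_split hs
  obtain ⟨g1, g2, g3, g4⟩ := (hr.armSum_eq hc n).1 ha
  obtain ⟨hl, hrad⟩ := maxRounds_spec (d := d) (b := b) (T := T) (k := k) hc
  refine ⟨by rw [g2, hp1], ?_⟩
  rw [g3, g4]
  simp only [BinState.mean, hp0, hp1] at hm
  have hl0 : (0 : ℝ) < maxRounds d b c₀ T k := by exact_mod_cast hl
  rw [sub_le_iff_le_add, ← sub_le_iff_le_add', ← sub_div, div_le_iff₀ hl0] at hm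
  nlinarith [mul_le_mul_of_nonneg_right hrad hl0.le]

theorem one_div_sqrt_succ_le (v : ℝ) (hv : 0 ≤ v) :
    1 / √(v + 1) ≤ 2 * √(v + 1) - 2 * √v := by
  have h1 : 0 < √(v + 1) := Real.sqrt_pos.2 (by linarith)
  have h2 := Real.sq_sqrt hv
  have h3 := Real.sq_sqrt (by linarith : (0 : ℝ) ≤ v + 1)
  rw [div_le_iff₀ h1]
  nlinarith [sq_nonneg (√(v + 1) - √v)]

/-- The weight `1/√v` of the `v`-th visit. -/
noncomputable def visitWeight (s : BinState) : ℝ := 1 / √((s.pulls 0 : ℝ) + s.pulls 1 + 1)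

theorem visitWeight_nonneg (s : BinState) : 0 ≤ visitWeight s := by unfold visitWeight; positivity

theorem visitWeight_le_one (s : BinState) : visitWeight s ≤ 1 := by
  unfold visitWeight
  have h : (1 : ℝ) ≤ √((s.pulls 0 : ℝ) + s.pulls 1 + 1) := by
    rw [Real.one_le_sqrt]
    have : (0 : ℝ) ≤ (s.pulls 0 : ℝ) + s.pulls 1 := by positivity
    linarith
  rw [div_le_one (by linarith)]
  exact h

/-- As `∑ 1/√v ≤ 2 √n` over `1 ≤ v ≤ n`, and the pulls while both arms are active are the first
visits of the bin. -/
theorem IsBinRun.sum_visitWeight_le (hc : 0 < c₀) (hr : IsBinRun d b c₀ T k s c y) (n : ℕ) :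
    armSum s c 0 (fun t => visitWeight (s t)) n + armSum s c 1 (fun t => visitWeight (s t)) n
      ≤ 2 * √(armSum s c 0 (fun _ => 1) n + armSum s c 1 (fun _ => 1) n) := by
  have hv := hr.valid hc
  induction n with
  | zero => simp [armSum_zero]
  | succ n ih =>
    rcases hr.trichotomy (fun n => (hv n).alternate) n with
      ⟨-, h2⟩ | ⟨-, -, -, h2⟩ | ⟨ha, -, -, -, h0, h1⟩ | ⟨ha, -, -, -, h0, h1⟩
    · simp only [h2]; exact ih
    · simp only [h2]; exact ih
    all_goals
      obtain ⟨g1, g2, -, -⟩ := (hr.armSum_eq hc n).1 ha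
      have key := one_div_sqrt_succ_le ((s n).pulls 0 + (s n).pulls 1) (by positivity)
      simp only [h0, h1]
      rw [g1, g2] at ih ⊢
      rw [← visitWeight] at key
    · rw [add_right_comm ((s n).pulls 0 : ℝ)]; linarith
    · rw [← add_assoc ((s n).pulls 0 : ℝ)]; linarith

/-- An elimination forces the sum of the rewards, the `v`-th visit being weighted with `1/√v`, to
exceed every lower bound `θ` of the quantities `√(2τ) U(τ)` over the possible rounds `τ`. -/
theorem IsBinRun.le_of_active_ne (hc : 0 < c₀) (hr : IsBinRun d b c₀ T k s c y) {θ : ℝ}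
    (hθ : ∀ p : ℕ, 1 ≤ p → (k < maxDepth d b T → p ≤ maxRounds d b c₀ T k) →
      θ ≤ √(2 * p) * radius p (localHorizon d T k)) (n : ℕ) :
    ((s n).active = Finset.univ →
      ((s n).total 0 : ℝ) + (s n).total 1 ≤ √((s n).pulls 0 + (s n).pulls 1) *
        (armSum s c 0 (fun t => visitWeight (s t) * rewardValue (y t)) n +
          armSum s c 1 (fun t => visitWeight (s t) * rewardValue (y t)) n)) ∧
    ((s n).active ≠ Finset.univ →
      θ ≤ armSum s c 0 (fun t => visitWeight (s t) * rewardValue (y t)) n +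
          armSum s c 1 (fun t => visitWeight (s t) * rewardValue (y t)) n) := by
  have hv := hr.valid hc
  have key : ∀ (V W r : ℝ) (N : ℝ), 0 ≤ V → 0 ≤ W → N ≤ √V * W →
      N + r ≤ √(V + 1) * (W + 1 / √(V + 1) * r) := fun V W r N hV hW h => by
    have h1 : √V ≤ √(V + 1) := Real.sqrt_le_sqrt (by linarith)
    have h2 : 0 < √(V + 1) := Real.sqrt_pos.2 (by linarith)
    have h3 : √(V + 1) * (W + 1 / √(V + 1) * r) = √(V + 1) * W + r := by field_simp
    rw [h3]
    have := mul_le_mul_of_nonneg_right h1 hW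
    linarith
  have hnn : ∀ i n, 0 ≤ armSum s c i (fun t => visitWeight (s t) * rewardValue (y t)) n :=
    fun i n => armSum_nonneg i (fun t => mul_nonneg (visitWeight_nonneg _) (rewardValue_nonneg _)) n
  induction n with
  | zero => rw [hr.zero]; simp [BinState.init]
  | succ n ih =>
    rcases hr.trichotomy (fun n => (hv n).alternate) n with
      ⟨h1, h2⟩ | ⟨ha, h1, h2, h3⟩ | ⟨ha, hns, hp, hst, h0, h1⟩ | ⟨ha, hns, hp, hst, h0, h1⟩
    · rw [h1]; simp only [h2]; exact ih
    · rw [h1]; simp only [h3]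
      exact ⟨fun h => absurd h ha, ih.2⟩
    · obtain ⟨e1, e2, e3, e4, e5, e6⟩ := BinState.step_first (d := d) (b := b) (c₀ := c₀) (T := T)
        (k := k) ha hp (y n)
      have := key _ _ (rewardValue (y n)) _ (by positivity) (add_nonneg (hnn 0 n) (hnn 1 n))
        (ih.1 ha)
      rw [hst]
      refine ⟨fun _ => ?_, fun h => absurd e1 h⟩
      simp only [h0, h1, e3, e4, e5, e6]
      rw [← visitWeight] at this
      push_cast
      rw [add_right_comm ((s n).pulls 0 : ℝ)]
      linarith
    · obtain ⟨e1, e2, e3, e4, e5, e6⟩ := BinState.step_second (d := d) (b := b) (c₀ := c₀) (T := T)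
        (k := k) ha hp (y n)
      have := key _ _ (rewardValue (y n)) _ (by positivity) (add_nonneg (hnn 0 n) (hnn 1 n))
        (ih.1 ha)
      rw [← visitWeight, add_assoc _ _ (visitWeight (s n) * rewardValue (y n))] at this
      have hV : ((s n).pulls 0 : ℝ) + (s n).pulls 1 + 1 = (s n).pulls 0 + (s n).pulls 0 := by
        rw [hp]; push_cast; ring
      rw [hV] at this
      rw [hst]
      simp only [h0, h1, e1, e2, e3, e4]
      refine ⟨fun _ => by linarith, fun h => ?_⟩
      set p := (s n).pulls 0 with hpdef
      have hp1 : 1 ≤ p := by omega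
      have hp0 : (0 : ℝ) < p := by exact_mod_cast hp1
      have hsq : 0 < √(2 * (p : ℝ)) := Real.sqrt_pos.2 (by positivity)
      have hcap : k < maxDepth d b T → p ≤ maxRounds d b c₀ T k := fun hk => by
        have := (hv n).cap ha hns hk
        omega
      rw [Ne, e5] at h
      push Not at h
      obtain ⟨i, j, hij⟩ := h
      simp only [BinState.mean] at hij
      set s' := (s n).step d b c₀ T k (y n) with hs'
      have hpi : ∀ i, s'.pulls i = p := fun i => by fin_cases i <;> simp [e1, e2]
      rw [hpi, hpi, lt_sub_iff_add_lt, ← lt_sub_iff_add_lt', ← sub_div, lt_div_iff₀ hp0] at hij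
      have htot : (s'.total j : ℝ) ≤ s'.total 0 + s'.total 1 := by
        fin_cases j
        · simp
        · simp
      have hti : (0 : ℝ) ≤ s'.total i := by positivity
      rw [e3, e4] at htot
      rw [← two_mul (p : ℝ)] at this
      refine (hθ p hp1 hcap).trans (le_of_mul_le_mul_left ?_ hsq)
      rw [← mul_assoc, Real.mul_self_sqrt (by positivity)]
      linarith

end Run

end ABSE

/-! ### The bins containing a fixed context -/

namespace ABSE

section Chain

variable {d : ℕ} {b c₀ : ℝ} {T : ℕ}

/-- The reward of arm `i` in a period. -/
def potential (i : Arm) (z : Context d × (Bool × Bool)) : Bool := if i = 0 then z.2.1 else z.2.2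

/-- The states of all bins after `t` periods of `ABSE(b)`. -/
noncomputable def runStates (d : ℕ) (b c₀ : ℝ) (T : ℕ) (ω : ℕ → Context d × (Bool × Bool))
    (t : ℕ) : Bin d → BinState :=
  states d b c₀ T ((abse d b c₀ T).history ω t)

theorem action_abse (ω : ℕ → Context d × (Bool × Bool)) (t : ℕ) :
    (abse d b c₀ T).action ω t =
      (runStates d b c₀ T ω t (liveBin (runStates d b c₀ T ω t) (ω t).1)).nextArm := rfl

open Classical in
theorem runStates_succ (ω : ℕ → Context d × (Bool × Bool)) (t : ℕ) :
    runStates d b c₀ T ω (t + 1) =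
      Function.update (runStates d b c₀ T ω t) (liveBin (runStates d b c₀ T ω t) (ω t).1)
        ((runStates d b c₀ T ω t (liveBin (runStates d b c₀ T ω t) (ω t).1)).step d b c₀ T
          (liveBin (runStates d b c₀ T ω t) (ω t).1).1
          (potential (runStates d b c₀ T ω t (liveBin (runStates d b c₀ T ω t) (ω t).1)).nextArm
            (ω t))) := rfl

theorem lt_maxDepth_of_split (ω : ℕ → Context d × (Bool × Bool)) (t : ℕ) (B : Bin d)
    (h : (runStates d b c₀ T ω t B).split) : B.1 < maxDepth d b T := by
  induction t with
  | zero => exact absurd h id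
  | succ t ih =>
    rw [runStates_succ] at h
    rw [Function.update_apply] at h
    split_ifs at h with hB
    · rw [← hB] at h
      rw [BinState.step, BinState.endRound] at h
      split_ifs at h with h1
      · exact h.2.2
      · exact ih h
    · exact ih h

/-- The bin of depth `j` containing `x` is live. -/
def IsLive (st : Bin d → BinState) (x : Context d) (j : ℕ) : Prop :=
  (∀ i < j, (st (binOf i x)).split) ∧ ¬ (st (binOf j x)).split

theorem IsLive.liveBin_eq {st : Bin d → BinState} {x : Context d} {j : ℕ} (h : IsLive st x j) :
    liveBin st x = binOf j x := by
  have : sInf {k : ℕ | ¬ (st (binOf k x)).split} = j := by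
    refine le_antisymm (Nat.sInf_le h.2) ?_
    by_contra hlt
    push Not at hlt
    have hmem := Nat.sInf_mem (s := {k : ℕ | ¬ (st (binOf k x)).split}) ⟨j, h.2⟩
    exact hmem (h.1 _ hlt)
  rw [liveBin, this]

theorem IsLive.unique {st : Bin d → BinState} {x : Context d} {i j : ℕ} (hi : IsLive st x i)
    (hj : IsLive st x j) : i = j := by
  rcases lt_trichotomy i j with h | h | h
  · exact absurd (hj.1 i h) hi.2
  · exact h
  · exact absurd (hi.1 j h) hj.2

theorem exists_isLive {st : Bin d → BinState} {x : Context d} {k : ℕ}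
    (h : ¬ (st (binOf k x)).split) : ∃ j ≤ k, IsLive st x j := by
  classical
  have hex : ∃ j, ¬ (st (binOf j x)).split := ⟨k, h⟩
  refine ⟨Nat.find hex, Nat.find_min' hex h, fun i hi => ?_, Nat.find_spec hex⟩
  have := Nat.find_min hex hi
  push Not at this
  exact this

theorem not_split_maxDepth (ω : ℕ → Context d × (Bool × Bool)) (t : ℕ) (x : Context d) :
    ¬ (runStates d b c₀ T ω t (binOf (maxDepth d b T) x)).split := fun h =>
  lt_irrefl _ (lt_maxDepth_of_split ω t _ h)

theorem IsLive.congr {st : Bin d → BinState} {x x' : Context d} {j : ℕ} (h : IsLive st x j)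
    (hx : x' ∈ cell j x) : IsLive st x' j := by
  have e : ∀ i ≤ j, binOf i x' = binOf i x := fun i hi => binOf_eq_of_le hi hx
  refine ⟨fun i hi => ?_, ?_⟩
  · rw [e i hi.le]; exact h.1 i hi
  · rw [e j le_rfl]; exact h.2

theorem cell_subset {i j : ℕ} (hij : i ≤ j) (x : Context d) : cell j x ⊆ cell i x :=
  fun _ hy => binOf_eq_of_le hij hy

theorem liveBin_runStates_eq_iff (ω : ℕ → Context d × (Bool × Bool)) (t : ℕ) (x x' : Context d)
    (j : ℕ) : liveBin (runStates d b c₀ T ω t) x' = binOf j x ↔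
      IsLive (runStates d b c₀ T ω t) x j ∧ x' ∈ cell j x := by
  constructor
  · intro h
    obtain ⟨i, -, hi⟩ := exists_isLive (not_split_maxDepth (b := b) (c₀ := c₀) (T := T) ω t x')
    rw [hi.liveBin_eq] at h
    have hij : i = j := congrArg Prod.fst h
    subst hij
    exact ⟨hi.congr h.symm, h⟩
  · rintro ⟨h1, h2⟩
    rw [(h1.congr h2).liveBin_eq]
    exact h2

/-- The period `t` is spent in the bin of depth `j` containing `x`. -/
def Visits (b c₀ : ℝ) (T : ℕ) (x : Context d) (j : ℕ) (ω : ℕ → Context d × (Bool × Bool))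
    (t : ℕ) : Prop :=
  IsLive (runStates d b c₀ T ω t) x j ∧ (ω t).1 ∈ cell j x

theorem isBinRun (ω : ℕ → Context d × (Bool × Bool)) (x : Context d) (j : ℕ) :
    IsBinRun d b c₀ T j (fun t => runStates d b c₀ T ω t (binOf j x)) (Visits b c₀ T x j ω)
      (fun t => potential (runStates d b c₀ T ω t (binOf j x)).nextArm (ω t)) where
  zero := rfl
  succ_of_visit t h := by
    have h' := (liveBin_runStates_eq_iff ω t x (ω t).1 j).2 h
    rw [runStates_succ, h', Function.update_self]
    rfl
  succ_of_not_visit t h := by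
    have h' := mt (liveBin_runStates_eq_iff ω t x (ω t).1 j).1 h
    rw [runStates_succ, Function.update_of_ne (Ne.symm h')]
  not_split t h := h.1.2

/-! ### Measurability and independence -/

instance : MeasurableSpace BinState := ⊤

instance : DiscreteMeasurableSpace BinState := ⟨fun _ => trivial⟩

instance : Countable BinState := by
  refine Function.Injective.countable (β := Finset Arm × (Arm → ℕ) × (Arm → ℕ) × Prop)
    (f := fun s => (s.active, s.pulls, s.total, s.split)) fun s s' h => ?_
  cases s; cases s'
  simp_all

/-- The σ-algebra generated by the first `t` periods. -/
abbrev past (d t : ℕ) : MeasurableSpace (ℕ → Context d × (Bool × Bool)) :=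
  MeasurableSpace.comap (fun ω (i : Finset.range t) => ω i) inferInstance

theorem past_le (t : ℕ) : past d t ≤ MeasurableSpace.pi := by
  refine Measurable.comap_le ?_
  exact measurable_pi_lambda _ fun i => measurable_pi_apply _

theorem measurable_past_eval {r t : ℕ} (h : r < t) :
    Measurable[past d t] fun ω : ℕ → Context d × (Bool × Bool) => ω r := by
  have := measurable_pi_apply (X := fun _ : Finset.range t => Context d × (Bool × Bool))
    ⟨r, Finset.mem_range.2 h⟩
  exact this.comp (comap_measurable _)

theorem measurable_runStates (x : Context d) {r t : ℕ} (h : r ≤ t) (j : ℕ) :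
    Measurable[past d t] fun ω => runStates d b c₀ T ω r (binOf j x) := by
  classical
  induction r generalizing j with
  | zero => exact @measurable_const _ _ _ (past d t) BinState.init
  | succ r ih =>
    let G : (Fin (j + 1) → BinState) × Prop × Bool × Bool → BinState := fun q =>
      if ((∀ i : Fin (j + 1), i.1 < j → (q.1 i).split) ∧ ¬ (q.1 (Fin.last j)).split) ∧ q.2.1 then
        (q.1 (Fin.last j)).step d b c₀ T j
          (if (q.1 (Fin.last j)).nextArm = 0 then q.2.2.1 else q.2.2.2)
      else q.1 (Fin.last j)
    have hG : Measurable G := measurable_of_countable G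
    have hx := measurable_past_eval (d := d) (r := r) (t := t) (by omega)
    have h1 : Measurable[past d t] fun ω (i : Fin (j + 1)) =>
        runStates d b c₀ T ω r (binOf i x) :=
      @measurable_pi_lambda _ _ _ (past d t) _ _ fun i => ih (by omega) i
    have h2 : Measurable[past d t] fun ω : ℕ → Context d × (Bool × Bool) =>
        ((ω r).1 ∈ cell j x) :=
      (measurableSet_setOfPred.1 (measurableSet_cell j x)).comp (measurable_fst.comp hx)
    have h3 : Measurable[past d t] fun ω : ℕ → Context d × (Bool × Bool) => (ω r).2 :=
      measurable_snd.comp hx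
    have := hG.comp (h1.prodMk (h2.prodMk h3))
    convert this using 2 with ω
    have hrun := isBinRun (b := b) (c₀ := c₀) (T := T) ω x j
    have hiff : Visits b c₀ T x j ω r ↔
        ((∀ i : Fin (j + 1), i.1 < j → (runStates d b c₀ T ω r (binOf i x)).split) ∧
          ¬ (runStates d b c₀ T ω r (binOf j x)).split) ∧ (ω r).1 ∈ cell j x := by
      rw [Visits, IsLive]
      refine and_congr_left' (and_congr_left' ⟨fun h i hi => h i hi, fun h i hi => ?_⟩)
      exact h ⟨i, by omega⟩ hi
    by_cases hc : Visits b c₀ T x j ω r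
    · refine (hrun.succ_of_visit r hc).trans ?_
      exact (if_pos (hiff.1 hc)).symm
    · refine (hrun.succ_of_not_visit r hc).trans ?_
      exact (if_neg fun h => hc (hiff.2 h)).symm

theorem measurableSet_past_state (x : Context d) (t j : ℕ) (p : BinState → Prop) :
    MeasurableSet[past d t] {ω | p (runStates d b c₀ T ω t (binOf j x))} :=
  measurable_runStates x le_rfl j (MeasurableSet.of_discrete (s := {s | p s}))

theorem measurableSet_past_isLive (x : Context d) (t j : ℕ) :
    MeasurableSet[past d t] {ω | IsLive (runStates d b c₀ T ω t) x j} := by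
  have h1 : MeasurableSet[past d t]
      {ω | ∀ i < j, (runStates d b c₀ T ω t (binOf i x)).split} := by
    have : {ω | ∀ i < j, (runStates d b c₀ T ω t (binOf i x)).split}
        = ⋂ i, ⋂ _ : i < j, {ω | (runStates d b c₀ T ω t (binOf i x)).split} := by
      ext; simp
    rw [this]
    exact MeasurableSet.iInter fun i => MeasurableSet.iInter fun _ =>
      measurableSet_past_state x t i fun s => s.split
  exact h1.inter (measurableSet_past_state x t j fun s => ¬ s.split)

theorem measurePreserving_eval (P : Problem d) (t : ℕ) :
    MeasurePreserving (fun ω : ℕ → Context d × (Bool × Bool) => ω t) P.law P.stepLaw :=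
  measurePreserving_eval_infinitePi (fun _ => P.stepLaw) t

instance (P : Problem d) : IsProbabilityMeasure P.law := by
  unfold Problem.law; infer_instance

/-- The sample of a period is independent of the past. -/
theorem integral_past_mul (P : Problem d) (t : ℕ) {φ : (ℕ → Context d × (Bool × Bool)) → ℝ}
    (hφ : Measurable[past d t] φ) {g : Context d × (Bool × Bool) → ℝ} (hg : Measurable g) :
    ∫ ω, φ ω * g (ω t) ∂P.law = (∫ ω, φ ω ∂P.law) * ∫ z, g z ∂P.stepLaw := by
  have hind : iIndepFun (fun (i : ℕ) (ω : ℕ → Context d × (Bool × Bool)) => ω i) P.law :=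
    iIndepFun_infinitePi (P := fun _ : ℕ => P.stepLaw) (X := fun _ z => z)
      fun _ => measurable_id
  have h1 := hind.indepFun_finset (Finset.range t) {t} (by simp) fun i => measurable_pi_apply i
  have hψ : Measurable fun v : ({t} : Finset ℕ) → Context d × (Bool × Bool) =>
      g (v ⟨t, Finset.mem_singleton_self t⟩) := hg.comp (measurable_pi_apply _)
  have h2 : IndepFun (fun ω (i : Finset.range t) => ω i)
      (fun ω : ℕ → Context d × (Bool × Bool) => g (ω t)) P.law :=
    h1.comp measurable_id hψ
  have h3 : IndepFun φ (fun ω : ℕ → Context d × (Bool × Bool) => g (ω t)) P.law := by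
    rw [IndepFun_iff_Indep] at h2 ⊢
    exact indep_of_indep_of_le_left h2 hφ.comap_le
  rw [h3.integral_fun_mul_eq_mul_integral (hφ.mono (past_le t) le_rfl).aestronglyMeasurable
    (hg.comp (measurable_pi_apply t)).aestronglyMeasurable]
  congr 1
  rw [← (measurePreserving_eval P t).map_eq,
    integral_map (measurable_pi_apply t).aemeasurable hg.aestronglyMeasurable]

end Chain

end ABSE

/-! ### Expectations of the sums over a run, and the regret -/

namespace ABSE

section Expectation

variable {d : ℕ} {b c₀ : ℝ} {T : ℕ}

theorem measurable_payoff (P : Problem d) (i : Arm) : Measurable (P.payoff i) :=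
  ((P.reward i).measurable_coe (measurableSet_singleton true)).ennreal_toReal

theorem payoff_nonneg (P : Problem d) (i : Arm) (x : Context d) : 0 ≤ P.payoff i x :=
  measureReal_nonneg

theorem payoff_le_one (P : Problem d) (i : Arm) (x : Context d) : P.payoff i x ≤ 1 :=
  measureReal_le_one

theorem measurable_potential (i : Arm) :
    Measurable (potential i : Context d × (Bool × Bool) → Bool) := by
  unfold potential
  split_ifs
  exacts [measurable_fst.comp measurable_snd, measurable_snd.comp measurable_snd]

theorem measurable_rewardValue : Measurable rewardValue := measurable_of_countable _

theorem integral_stepLaw_context (P : Problem d) {f : Context d → ℝ} (hf : Measurable f) :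
    ∫ z, f z.1 ∂P.stepLaw = ∫ x, f x ∂P.covariate := by
  have h : P.stepLaw.map Prod.fst = P.covariate := by
    rw [← Measure.fst, Problem.stepLaw, Measure.fst_compProd]
  conv_rhs => rw [← h]
  rw [integral_map measurable_fst.aemeasurable hf.aestronglyMeasurable]

theorem integral_stepLaw_reward (P : Problem d) {S : Set (Context d)} (hS : MeasurableSet S)
    (i : Arm) :
    ∫ z, S.indicator 1 z.1 * rewardValue (potential i z) ∂P.stepLaw
      = ∫ x in S, P.payoff i x ∂P.covariate := by
  let R : Set (Bool × Bool) := {y | (if i = 0 then y.1 else y.2) = true}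
  have hR : MeasurableSet R := MeasurableSet.of_discrete
  have h1 : (fun z : Context d × (Bool × Bool) => S.indicator (1 : Context d → ℝ) z.1 *
      rewardValue (potential i z)) = (S ×ˢ R).indicator 1 := by
    funext z
    by_cases hz : z.1 ∈ S <;> by_cases hz2 : potential i z = true
    · have : z ∈ S ×ˢ R := ⟨hz, hz2⟩
      simp [hz, this, rewardValue, hz2]
    · have : z ∉ S ×ˢ R := fun h => hz2 h.2
      simp [this, rewardValue, hz2]
    · have : z ∉ S ×ˢ R := fun h => hz h.1
      simp [this, hz]
    · have : z ∉ S ×ˢ R := fun h => hz h.1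
      simp [this, hz]
  have h2 : ∀ x, (P.reward 0 ×ₖ P.reward 1) x R = P.reward i x {true} := by
    intro x
    rw [Kernel.prod_apply]
    fin_cases i
    · have : R = {true} ×ˢ Set.univ := by ext y; simp [R]
      rw [this, Measure.prod_prod, measure_univ]
      simp
    · have : R = Set.univ ×ˢ {true} := by ext y; simp [R]
      rw [this, Measure.prod_prod, measure_univ]
      simp
  rw [h1, integral_indicator_one (hS.prod hR), measureReal_def, Problem.stepLaw,
    Measure.compProd_apply_prod hS hR]
  simp only [h2]
  rw [← integral_toReal ((P.reward i).measurable_coe (measurableSet_singleton true)).aemeasurable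
    (ae_of_all _ fun x => measure_lt_top _ _)]
  rfl

/-- The bin of depth `j` containing `x` is live in period `t`, both arms are active in it, and
its next arm is `i`. -/
def armEvent (b c₀ : ℝ) (T : ℕ) (x : Context d) (j : ℕ) (i : Arm) (t : ℕ) :
    Set (ℕ → Context d × (Bool × Bool)) :=
  {ω | IsLive (runStates d b c₀ T ω t) x j ∧
    (runStates d b c₀ T ω t (binOf j x)).active = Finset.univ ∧
    (runStates d b c₀ T ω t (binOf j x)).nextArm = i}

theorem measurableSet_past_armEvent (x : Context d) (j : ℕ) (i : Arm) (t : ℕ) :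
    MeasurableSet[past d t] (armEvent b c₀ T x j i t) :=
  (measurableSet_past_isLive x t j).inter ((measurableSet_past_state x t j fun s =>
    s.active = Finset.univ).inter (measurableSet_past_state x t j fun s => s.nextArm = i))

theorem measurableSet_armEvent (x : Context d) (j : ℕ) (i : Arm) (t : ℕ) :
    MeasurableSet (armEvent b c₀ T x j i t) :=
  past_le t _ (measurableSet_past_armEvent x j i t)

/-- The sum of the weights `w t ω` over the first `n` periods in which the bin of depth `j`
containing `x` is visited while both arms are active and arm `i` is pulled. -/
noncomputable def runSum (b c₀ : ℝ) (T : ℕ) (x : Context d) (j : ℕ) (i : Arm)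
    (w : ℕ → (ℕ → Context d × (Bool × Bool)) → ℝ) (n : ℕ) (ω : ℕ → Context d × (Bool × Bool)) :
    ℝ :=
  armSum (fun t => runStates d b c₀ T ω t (binOf j x)) (Visits b c₀ T x j ω) i (fun t => w t ω) n

/-- The expected sum of the weights `ψ` of the states over the periods in `armEvent`. -/
noncomputable def armMass (P : Problem d) (b c₀ : ℝ) (T : ℕ) (x : Context d) (j : ℕ) (i : Arm)
    (ψ : BinState → ℝ) (n : ℕ) : ℝ :=
  ∑ t ∈ Finset.range n, ∫ ω, (armEvent b c₀ T x j i t).indicator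
    (fun ω => ψ (runStates d b c₀ T ω t (binOf j x))) ω ∂P.law

theorem runSum_eq (x : Context d) (j : ℕ) (i : Arm) (ψ : BinState → ℝ)
    (g : Context d × (Bool × Bool) → ℝ) (n : ℕ) :
    runSum b c₀ T x j i
      (fun t ω => ψ (runStates d b c₀ T ω t (binOf j x)) * g (ω t)) n =
    fun ω => ∑ t ∈ Finset.range n, (armEvent b c₀ T x j i t).indicator
      (fun ω => ψ (runStates d b c₀ T ω t (binOf j x))) ω *
        ((cell j x).indicator 1 (ω t).1 * g (ω t)) := by
  funext ω
  rw [runSum, armSum]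
  refine Finset.sum_congr rfl fun t _ => ?_
  simp only [Set.indicator, armEvent, Visits, Set.mem_ofPred_eq]
  by_cases h1 : IsLive (runStates d b c₀ T ω t) x j <;>
  by_cases h2 : (ω t).1 ∈ cell j x <;>
  simp [h1, h2]

theorem measurable_past_indicator (x : Context d) (j : ℕ) (i : Arm) (ψ : BinState → ℝ) (t : ℕ) :
    Measurable[past d t] ((armEvent b c₀ T x j i t).indicator
      (fun ω => ψ (runStates d b c₀ T ω t (binOf j x)))) :=
  Measurable.indicator ((measurable_of_countable ψ).comp (measurable_runStates x le_rfl j))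
    (measurableSet_past_armEvent x j i t)

theorem measurable_cell_mul (x : Context d) (j : ℕ) {g : Context d × (Bool × Bool) → ℝ}
    (hg : Measurable g) : Measurable fun z => (cell j x).indicator (1 : Context d → ℝ) z.1 * g z :=
  ((measurable_one.indicator (measurableSet_cell j x)).comp measurable_fst).mul hg

theorem integrable_term (P : Problem d) (x : Context d) (j : ℕ) (i : Arm) {ψ : BinState → ℝ}
    (hψ : ∀ s, |ψ s| ≤ 1) {g : Context d × (Bool × Bool) → ℝ} (hg : Measurable g)
    (hg1 : ∀ z, |g z| ≤ 1) (t : ℕ) :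
    Integrable (fun ω => (armEvent b c₀ T x j i t).indicator
      (fun ω => ψ (runStates d b c₀ T ω t (binOf j x))) ω *
        ((cell j x).indicator 1 (ω t).1 * g (ω t))) P.law := by
  refine Integrable.of_bound (C := 1) (Measurable.aestronglyMeasurable ?_) (ae_of_all _ fun ω => ?_)
  · exact ((measurable_past_indicator x j i ψ t).mono (past_le t) le_rfl).mul
      ((measurable_cell_mul x j hg).comp (measurable_pi_apply t))
  · have h1 : |(armEvent b c₀ T x j i t).indicator
        (fun ω => ψ (runStates d b c₀ T ω t (binOf j x))) ω| ≤ 1 := by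
      by_cases h : ω ∈ armEvent b c₀ T x j i t <;> simp [h, hψ]
    have h2 : |(cell j x).indicator (1 : Context d → ℝ) (ω t).1| ≤ 1 := by
      by_cases h : (ω t).1 ∈ cell j x <;> simp [h]
    rw [Real.norm_eq_abs, abs_mul, abs_mul]
    exact mul_le_one₀ h1 (by positivity) (mul_le_one₀ h2 (abs_nonneg _) (hg1 _))

theorem integrable_runSum (P : Problem d) (x : Context d) (j : ℕ) (i : Arm) {ψ : BinState → ℝ}
    (hψ : ∀ s, |ψ s| ≤ 1) {g : Context d × (Bool × Bool) → ℝ} (hg : Measurable g)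
    (hg1 : ∀ z, |g z| ≤ 1) (n : ℕ) :
    Integrable (runSum b c₀ T x j i
      (fun t ω => ψ (runStates d b c₀ T ω t (binOf j x)) * g (ω t)) n) P.law := by
  rw [runSum_eq]
  exact integrable_finsetSum _ fun t _ => integrable_term P x j i hψ hg hg1 t

theorem integral_runSum (P : Problem d) (x : Context d) (j : ℕ) (i : Arm) {ψ : BinState → ℝ}
    (hψ : ∀ s, |ψ s| ≤ 1) {g : Context d × (Bool × Bool) → ℝ} (hg : Measurable g)
    (hg1 : ∀ z, |g z| ≤ 1) (n : ℕ) :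
    ∫ ω, runSum b c₀ T x j i
      (fun t ω => ψ (runStates d b c₀ T ω t (binOf j x)) * g (ω t)) n ω ∂P.law =
    armMass P b c₀ T x j i ψ n * ∫ z, (cell j x).indicator 1 z.1 * g z ∂P.stepLaw := by
  rw [runSum_eq, integral_finsetSum _ fun t _ => integrable_term P x j i hψ hg hg1 t, armMass,
    Finset.sum_mul]
  exact Finset.sum_congr rfl fun t _ =>
    integral_past_mul P t (measurable_past_indicator x j i ψ t) (measurable_cell_mul x j hg)

theorem runSum_congr (x : Context d) (j : ℕ) (i : Arm)
    {w w' : ℕ → (ℕ → Context d × (Bool × Bool)) → ℝ}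
    (h : ∀ t ω, (runStates d b c₀ T ω t (binOf j x)).nextArm = i → w t ω = w' t ω) (n : ℕ) :
    runSum b c₀ T x j i w n = runSum b c₀ T x j i w' n := by
  funext ω
  simp only [runSum, armSum]
  refine Finset.sum_congr rfl fun t _ => ?_
  split_ifs with hc
  · exact h t ω hc.2.2
  · rfl

/-- The sum of the weights `ψ` of the states in which arm `i` is pulled while both arms are active. -/
noncomputable def pullSum (b c₀ : ℝ) (T : ℕ) (x : Context d) (j : ℕ) (i : Arm)
    (ψ : BinState → ℝ) (n : ℕ) : (ℕ → Context d × (Bool × Bool)) → ℝ :=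
  runSum b c₀ T x j i (fun t ω => ψ (runStates d b c₀ T ω t (binOf j x))) n

/-- The sum of the rewards of arm `i`, weighted with `ψ`, over the same pulls as in `pullSum`. -/
noncomputable def rewardSum (b c₀ : ℝ) (T : ℕ) (x : Context d) (j : ℕ) (i : Arm)
    (ψ : BinState → ℝ) (n : ℕ) : (ℕ → Context d × (Bool × Bool)) → ℝ :=
  runSum b c₀ T x j i (fun t ω => ψ (runStates d b c₀ T ω t (binOf j x)) *
    rewardValue (potential (runStates d b c₀ T ω t (binOf j x)).nextArm (ω t))) n

theorem pullSum_eq (x : Context d) (j : ℕ) (i : Arm) (ψ : BinState → ℝ) (n : ℕ) :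
    pullSum b c₀ T x j i ψ n = runSum b c₀ T x j i
      (fun t ω => ψ (runStates d b c₀ T ω t (binOf j x)) * (fun _ => 1) (ω t)) n :=
  runSum_congr x j i (fun t ω _ => by simp) n

theorem rewardSum_eq (x : Context d) (j : ℕ) (i : Arm) (ψ : BinState → ℝ) (n : ℕ) :
    rewardSum b c₀ T x j i ψ n = runSum b c₀ T x j i
      (fun t ω => ψ (runStates d b c₀ T ω t (binOf j x)) *
        (fun z => rewardValue (potential i z)) (ω t)) n :=
  runSum_congr x j i (fun t ω h => by simp [h]) n

theorem abs_rewardValue_le (y : Bool) : |rewardValue y| ≤ 1 := by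
  rw [abs_of_nonneg (rewardValue_nonneg y)]; exact rewardValue_le_one y

theorem integrable_pullSum (P : Problem d) (x : Context d) (j : ℕ) (i : Arm) {ψ : BinState → ℝ}
    (hψ : ∀ s, |ψ s| ≤ 1) (n : ℕ) : Integrable (pullSum b c₀ T x j i ψ n) P.law := by
  rw [pullSum_eq]
  exact integrable_runSum P x j i hψ measurable_const (by simp) n

theorem integrable_rewardSum (P : Problem d) (x : Context d) (j : ℕ) (i : Arm)
    {ψ : BinState → ℝ} (hψ : ∀ s, |ψ s| ≤ 1) (n : ℕ) :
    Integrable (rewardSum b c₀ T x j i ψ n) P.law := by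
  rw [rewardSum_eq]
  exact integrable_runSum P x j i hψ (measurable_rewardValue.comp (measurable_potential i))
    (fun _ => abs_rewardValue_le _) n

theorem integral_pullSum (P : Problem d) (x : Context d) (j : ℕ) (i : Arm) {ψ : BinState → ℝ}
    (hψ : ∀ s, |ψ s| ≤ 1) (n : ℕ) :
    ∫ ω, pullSum b c₀ T x j i ψ n ω ∂P.law =
      armMass P b c₀ T x j i ψ n * P.covariate.real (cell j x) := by
  rw [pullSum_eq, integral_runSum P x j i hψ measurable_const (by simp)]
  congr 1
  simp only [mul_one]
  rw [integral_stepLaw_context P (measurable_one.indicator (measurableSet_cell j x)),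
    integral_indicator_one (measurableSet_cell j x)]

theorem integral_rewardSum (P : Problem d) (x : Context d) (j : ℕ) (i : Arm) {ψ : BinState → ℝ}
    (hψ : ∀ s, |ψ s| ≤ 1) (n : ℕ) :
    ∫ ω, rewardSum b c₀ T x j i ψ n ω ∂P.law =
      armMass P b c₀ T x j i ψ n * ∫ z in cell j x, P.payoff i z ∂P.covariate := by
  rw [rewardSum_eq, integral_runSum P x j i hψ
    (g := fun z => rewardValue (potential i z))
    (measurable_rewardValue.comp (measurable_potential i)) (fun _ => abs_rewardValue_le _),
    integral_stepLaw_reward P (measurableSet_cell j x)]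

theorem armMass_nonneg (P : Problem d) (x : Context d) (j : ℕ) (i : Arm) {ψ : BinState → ℝ}
    (hψ : ∀ s, 0 ≤ ψ s) (n : ℕ) : 0 ≤ armMass P b c₀ T x j i ψ n :=
  Finset.sum_nonneg fun _ _ => integral_nonneg fun _ => Set.indicator_nonneg (fun _ _ => hψ _) _

theorem armMass_one (P : Problem d) (x : Context d) (j : ℕ) (i : Arm) (n : ℕ) :
    armMass P b c₀ T x j i (fun _ => 1) n =
      ∑ t ∈ Finset.range n, P.law.real (armEvent b c₀ T x j i t) :=
  Finset.sum_congr rfl fun t _ => integral_indicator_one (measurableSet_armEvent x j i t)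

/-! ### The regret as a sum over cells -/

/-- The loss of arm `a` relative to the better arm. -/
noncomputable def loss (P : Problem d) (a : Arm) (x : Context d) : ℝ :=
  max (P.payoff 0 x) (P.payoff 1 x) - P.payoff a x

theorem loss_nonneg (P : Problem d) (a : Arm) (x : Context d) : 0 ≤ loss P a x := by
  unfold loss
  fin_cases a
  · simp
  · simp

theorem loss_le_one (P : Problem d) (a : Arm) (x : Context d) : loss P a x ≤ 1 := by
  unfold loss
  have := max_le (payoff_le_one P 0 x) (payoff_le_one P 1 x)
  have := payoff_nonneg P a x
  linarith

theorem measurable_loss (P : Problem d) (a : Arm) : Measurable (loss P a) :=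
  ((measurable_payoff P 0).max (measurable_payoff P 1)).sub (measurable_payoff P a)

/-- In period `t` the live bin containing `x` has depth at most `k` and its next arm is `a`. -/
def pullEvent (b c₀ : ℝ) (T : ℕ) (x : Context d) (k : ℕ) (a : Arm) (t : ℕ) :
    Set (ℕ → Context d × (Bool × Bool)) :=
  {ω | ∃ j ≤ k, IsLive (runStates d b c₀ T ω t) x j ∧
    (runStates d b c₀ T ω t (binOf j x)).nextArm = a}

theorem measurableSet_past_pullEvent (x : Context d) (k : ℕ) (a : Arm) (t : ℕ) :
    MeasurableSet[past d t] (pullEvent b c₀ T x k a t) := by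
  have : pullEvent b c₀ T x k a t = ⋃ j, ⋃ _ : j ≤ k,
      {ω | IsLive (runStates d b c₀ T ω t) x j} ∩
        {ω | (runStates d b c₀ T ω t (binOf j x)).nextArm = a} := by
    ext
    simp only [pullEvent, Set.mem_ofPred_eq, Set.mem_iUnion, Set.mem_inter_iff, exists_prop]
  rw [this]
  exact MeasurableSet.iUnion fun j => MeasurableSet.iUnion fun _ =>
    (measurableSet_past_isLive x t j).inter
      (measurableSet_past_state x t j fun s => s.nextArm = a)

theorem measurableSet_pullEvent (x : Context d) (k : ℕ) (a : Arm) (t : ℕ) :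
    MeasurableSet (pullEvent b c₀ T x k a t) :=
  past_le t _ (measurableSet_past_pullEvent x k a t)

theorem action_eq_of_mem_pullEvent {x : Context d} {k : ℕ} {a : Arm} {t : ℕ}
    {ω : ℕ → Context d × (Bool × Bool)} (h : ω ∈ pullEvent b c₀ T x k a t)
    (hx : (ω t).1 ∈ cell k x) : (abse d b c₀ T).action ω t = a := by
  obtain ⟨j, hj, hl, ha⟩ := h
  rw [action_abse, (liveBin_runStates_eq_iff ω t x _ j).2 ⟨hl, cell_subset hj x hx⟩, ha]

/-- The regret is at least the sum, over any family of disjoint cells of depth `k`, of the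
losses incurred while the live bins containing these cells have depth at most `k`: then the same
arm is used on the whole cell, independently of the context of the period. -/
theorem ofReal_sum_le_regret (P : Problem d) (k n : ℕ) {ι : Type*} [Fintype ι]
    (x : ι → Context d) (hx : ∀ y, ∀ v w, y ∈ cell k (x v) → y ∈ cell k (x w) → v = w) :
    ENNReal.ofReal (∑ t ∈ Finset.range n, ∑ v, ∑ a, P.law.real (pullEvent b c₀ T (x v) k a t) *
      ∫ z in cell k (x v), loss P a z ∂P.covariate) ≤ (abse d b c₀ T).regret P n := by
  classical
  let F : ℕ → ι → Arm → (ℕ → Context d × (Bool × Bool)) → ℝ := fun t v a ω =>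
    (pullEvent b c₀ T (x v) k a t).indicator 1 ω *
      (cell k (x v)).indicator (loss P a) (ω t).1
  have hF0 : ∀ t v a ω, 0 ≤ F t v a ω := fun t v a ω =>
    mul_nonneg (Set.indicator_nonneg (fun _ _ => zero_le_one) _)
      (Set.indicator_nonneg (fun _ _ => loss_nonneg P a _) _)
  have hg : ∀ v a, Measurable ((cell k (x v)).indicator (loss P a)) := fun v a =>
    (measurable_loss P a).indicator (measurableSet_cell k (x v))
  have hφ : ∀ t v a, Measurable[past d t]
      ((pullEvent b c₀ T (x v) k a t).indicator (1 : (ℕ → Context d × (Bool × Bool)) → ℝ)) :=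
    fun t v a => Measurable.indicator (@measurable_const _ _ _ (past d t) 1)
      (measurableSet_past_pullEvent (x v) k a t)
  have hFm : ∀ t v a, Measurable (F t v a) := fun t v a =>
    ((hφ t v a).mono (past_le t) le_rfl).mul
      ((hg v a).comp (measurable_fst.comp (measurable_pi_apply t)))
  have hF1 : ∀ t v a ω, F t v a ω ≤ 1 := fun t v a ω => by
    refine mul_le_one₀ ?_ (Set.indicator_nonneg (fun _ _ => loss_nonneg P a _) _) ?_
    · exact Set.indicator_le' (fun _ _ => le_rfl) (fun _ _ => zero_le_one) _
    · exact Set.indicator_le' (fun _ _ => loss_le_one P a _) (fun _ _ => zero_le_one) _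
  have hFi : ∀ t v a, Integrable (F t v a) P.law := fun t v a =>
    Integrable.of_bound (hFm t v a).aestronglyMeasurable 1 (ae_of_all _ fun ω => by
      rw [Real.norm_eq_abs, abs_of_nonneg (hF0 t v a ω)]; exact hF1 t v a ω)
  have hint : ∀ t v a, ∫ ω, F t v a ω ∂P.law = P.law.real (pullEvent b c₀ T (x v) k a t) *
      ∫ z in cell k (x v), loss P a z ∂P.covariate := fun t v a => by
    have h := integral_past_mul P t (hφ t v a) ((hg v a).comp measurable_fst)
    rw [integral_indicator_one (measurableSet_pullEvent (x v) k a t)] at h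
    refine h.trans ?_
    congr 1
    rw [← integral_indicator (measurableSet_cell k (x v)), ← integral_stepLaw_context P (hg v a)]
    rfl
  have hsum : ∫ ω, ∑ t ∈ Finset.range n, ∑ v, ∑ a, F t v a ω ∂P.law =
      ∑ t ∈ Finset.range n, ∑ v, ∑ a, P.law.real (pullEvent b c₀ T (x v) k a t) *
      ∫ z in cell k (x v), loss P a z ∂P.covariate := by
    rw [integral_finsetSum _ fun t _ => integrable_finsetSum _ fun v _ =>
      integrable_finsetSum _ fun a _ => hFi t v a]
    refine Finset.sum_congr rfl fun t _ => ?_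
    rw [integral_finsetSum _ fun v _ => integrable_finsetSum _ fun a _ => hFi t v a]
    refine Finset.sum_congr rfl fun v _ => ?_
    rw [integral_finsetSum _ fun a _ => hFi t v a]
    exact Finset.sum_congr rfl fun a _ => hint t v a
  rw [← hsum, ofReal_integral_eq_lintegral_ofReal
    (integrable_finsetSum _ fun t _ => integrable_finsetSum _ fun v _ =>
      integrable_finsetSum _ fun a _ => hFi t v a)
    (ae_of_all _ fun ω => Finset.sum_nonneg fun t _ => Finset.sum_nonneg fun v _ =>
      Finset.sum_nonneg fun a _ => hF0 t v a ω)]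
  refine lintegral_mono fun ω => ENNReal.ofReal_le_ofReal (Finset.sum_le_sum fun t _ => ?_)
  change _ ≤ loss P ((abse d b c₀ T).action ω t) (ω t).1
  by_cases hv : ∃ v, (ω t).1 ∈ cell k (x v)
  · obtain ⟨v, hv⟩ := hv
    rw [Finset.sum_eq_single v]
    · rw [Finset.sum_eq_single ((abse d b c₀ T).action ω t)]
      · refine (mul_le_mul_of_nonneg_right (Set.indicator_le' (fun _ _ => le_rfl)
          (fun _ _ => zero_le_one) _) (Set.indicator_nonneg (fun _ _ => loss_nonneg P _ _) _)).trans ?_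
        rw [Set.indicator_of_mem hv]
        simp
      · intro a _ ha
        have : ω ∉ pullEvent b c₀ T (x v) k a t := fun h =>
          ha (action_eq_of_mem_pullEvent h hv).symm
        simp [F, this]
      · simp
    · intro w _ hw
      have : (ω t).1 ∉ cell k (x w) := fun h => hw (hx _ _ _ h hv)
      simp [F, this]
    · simp
  · push Not at hv
    have : ∀ v a, F t v a ω = 0 := fun v a => by simp [F, hv v]
    simp only [this, Finset.sum_const_zero]
    exact loss_nonneg P _ _

end Expectation

end ABSE

/-! ### Problem instances with truncated tents as payoff functions -/

namespace ABSE

/-- The problem with uniform contexts and the prescribed payoff functions. -/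
noncomputable def bernoulliProblem {d : ℕ} (f : Arm → Context d → ℝ) (hf : ∀ k, Measurable (f k))
    (h0 : ∀ k x, 0 ≤ f k x) (h1 : ∀ k x, f k x ≤ 1) : Problem d where
  covariate := volume
  reward k :=
    { toFun := fun x => ENNReal.ofReal (f k x) • Measure.dirac true +
        ENNReal.ofReal (1 - f k x) • Measure.dirac false
      measurable' := by
        refine Measure.measurable_of_measurable_coe _ fun s _ => ?_
        simp only [Measure.coe_add, Measure.coe_smul, Pi.add_apply, Pi.smul_apply, smul_eq_mul]
        exact ((hf k).ennreal_ofReal.mul_const _).add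
          ((measurable_const.sub (hf k)).ennreal_ofReal.mul_const _) }
  isProbabilityMeasure_covariate := inferInstance
  isMarkovKernel_reward k := ⟨fun x => ⟨by
    change (ENNReal.ofReal (f k x) • Measure.dirac true +
        ENNReal.ofReal (1 - f k x) • Measure.dirac false : Measure Bool) Set.univ = 1
    simp only [Measure.coe_add, Measure.coe_smul, Pi.add_apply, Pi.smul_apply, smul_eq_mul,
      measure_univ, mul_one]
    rw [← ENNReal.ofReal_add (h0 k x) (sub_nonneg.2 (h1 k x))]
    simp⟩⟩

theorem payoff_bernoulliProblem {d : ℕ} (f : Arm → Context d → ℝ) (hf : ∀ k, Measurable (f k))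
    (h0 : ∀ k x, 0 ≤ f k x) (h1 : ∀ k x, f k x ≤ 1) (k : Arm) (x : Context d) :
    (bernoulliProblem f hf h0 h1).payoff k x = f k x := by
  change (ENNReal.ofReal (f k x) • Measure.dirac true +
        ENNReal.ofReal (1 - f k x) • Measure.dirac false : Measure Bool).real {true} = f k x
  simp [measureReal_def, h0 k x]

/-- The function of the distance `ρ` to the origin which rises like `L r ^ β` with the distance
`r` to the complement of `(a - w, a + w)`, truncated at height `Δ`. -/
noncomputable def tent (β L Δ a w ρ : ℝ) : ℝ := min Δ (L * max (w - |ρ - a|) 0 ^ β)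

section Tent

variable {β L Δ a w : ℝ}

theorem tent_le (ρ : ℝ) : tent β L Δ a w ρ ≤ Δ := min_le_left _ _

theorem tent_nonneg (hL : 0 < L) (hΔ : 0 < Δ) (ρ : ℝ) : 0 ≤ tent β L Δ a w ρ :=
  le_min hΔ.le (mul_nonneg hL.le (Real.rpow_nonneg (le_max_right _ _) _))

theorem tent_eq_zero (hβ : 0 < β) (hΔ : 0 < Δ) {ρ : ℝ} (h : w ≤ |ρ - a|) :
    tent β L Δ a w ρ = 0 := by
  rw [tent, max_eq_right (by linarith), Real.zero_rpow hβ.ne', mul_zero, min_eq_right hΔ.le]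

theorem tent_eq_height (hβ : 0 < β) (hL : 0 < L) (hΔ : 0 < Δ) {ρ : ℝ}
    (h : (Δ / L) ^ (1 / β) ≤ w - |ρ - a|) : tent β L Δ a w ρ = Δ := by
  rw [tent, min_eq_left]
  have h1 : ((Δ / L) ^ (1 / β)) ^ β ≤ max (w - |ρ - a|) 0 ^ β :=
    Real.rpow_le_rpow (by positivity) (h.trans (le_max_left _ _)) hβ.le
  rw [← Real.rpow_mul (by positivity), one_div_mul_cancel hβ.ne', Real.rpow_one,
    div_le_iff₀ hL] at h1
  linarith

theorem abs_rpow_sub_rpow_le {β u v : ℝ} (hβ0 : 0 < β) (hβ1 : β ≤ 1) (hu : 0 ≤ u) (hv : 0 ≤ v) :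
    |u ^ β - v ^ β| ≤ |u - v| ^ β := by
  wlog h : v ≤ u generalizing u v
  · rw [abs_sub_comm, abs_sub_comm u]
    exact this hv hu (by linarith)
  have h1 := Real.rpow_le_rpow hv h hβ0.le
  have h2 := Real.rpow_add_le_add_rpow (sub_nonneg.2 h) hv hβ0.le hβ1
  rw [sub_add_cancel] at h2
  rw [abs_of_nonneg (by linarith), abs_of_nonneg (by linarith)]
  linarith

theorem abs_tent_sub_le (hβ0 : 0 < β) (hβ1 : β ≤ 1) (hL : 0 < L) (ρ ρ' : ℝ) :
    |tent β L Δ a w ρ - tent β L Δ a w ρ'| ≤ L * |ρ - ρ'| ^ β := by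
  unfold tent
  have h1 := abs_min_sub_min_le_max Δ (L * max (w - |ρ - a|) 0 ^ β) Δ (L * max (w - |ρ' - a|) 0 ^ β)
  refine h1.trans (max_le (by rw [sub_self, abs_zero]; positivity) ?_)
  rw [← mul_sub, abs_mul, abs_of_pos hL]
  refine mul_le_mul_of_nonneg_left ?_ hL.le
  refine (abs_rpow_sub_rpow_le hβ0 hβ1 (le_max_right _ _) (le_max_right _ _)).trans ?_
  refine Real.rpow_le_rpow (abs_nonneg _) ?_ hβ0.le
  refine (abs_max_sub_max_le_abs _ _ _).trans ?_
  have := abs_abs_sub_abs_le_abs_sub (ρ' - a) (ρ - a)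
  rw [sub_sub_sub_cancel_left]
  refine this.trans_eq ?_
  rw [sub_sub_sub_cancel_right, abs_sub_comm]

theorem measurable_tent : Measurable (tent β L Δ a w) := by
  unfold tent
  fun_prop

/-- A small positive value of the tent is attained only close to the ends of its support. -/
theorem mem_layers_of_tent_le (hβ : 0 < β) (hL : 0 < L) (hΔ : 0 < Δ) {δ ρ : ℝ}
    (hδΔ : δ < Δ) (h0 : 0 < tent β L Δ a w ρ) (h1 : tent β L Δ a w ρ ≤ δ) :
    (a - w ≤ ρ ∧ ρ ≤ a - w + (δ / L) ^ (1 / β)) ∨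
      (a + w - (δ / L) ^ (1 / β) ≤ ρ ∧ ρ ≤ a + w) := by
  have hw : |ρ - a| < w := by
    by_contra h
    rw [tent_eq_zero hβ hΔ (not_lt.1 h)] at h0
    exact lt_irrefl _ h0
  have h2 : L * (w - |ρ - a|) ^ β ≤ δ := by
    rw [tent, max_eq_left (by linarith), min_le_iff] at h1
    rcases h1 with h1 | h1
    · linarith
    · exact h1
  have h3 : w - |ρ - a| ≤ (δ / L) ^ (1 / β) := by
    rw [mul_comm, ← le_div_iff₀ hL] at h2
    have := Real.rpow_le_rpow (Real.rpow_nonneg (by linarith) _) h2 (one_div_pos.2 hβ).le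
    rwa [← Real.rpow_mul (by linarith), mul_one_div_cancel hβ.ne', Real.rpow_one] at this
  rcases le_total a ρ with h | h
  · rw [abs_of_nonneg (by linarith)] at h3 hw
    right; constructor <;> linarith
  · rw [abs_of_nonpos (by linarith)] at h3 hw
    left; constructor <;> linarith

end Tent

theorem volume_dist_zero_lt {d : ℕ} {a : ℝ} (h0 : 0 < a) (h1 : a ≤ 1) :
    (volume : Measure (Context d)).real {x | dist x 0 < a} = a ^ d := by
  have : {x : Context d | dist x 0 < a}
      = Set.pi Set.univ fun _ => Set.Iio (⟨a, h0.le, h1⟩ : unitInterval) := by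
    ext x
    simp only [Set.mem_ofPred_eq, dist_pi_lt_iff h0, Set.mem_pi, Set.mem_univ, true_imp_iff,
      Set.mem_Iio, ← Subtype.coe_lt_coe]
    refine forall_congr' fun i => ?_
    rw [Subtype.dist_eq, Real.dist_eq]
    simp [abs_of_nonneg (x i).2.1]
  rw [measureReal_def, this, volume_pi_pi]
  simp only [unitInterval.volume_Iio, Finset.prod_const, Finset.card_univ, Fintype.card_fin]
  rw [← ENNReal.ofReal_pow h0.le, ENNReal.toReal_ofReal (by positivity)]

theorem pow_sub_pow_mul_le {u v s : ℝ} (hu : 0 ≤ u) (huv : u ≤ v) (hvs : v ≤ s) (d : ℕ) :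
    (v ^ d - u ^ d) * s ≤ d * (v - u) * s ^ d := by
  have hs : 0 ≤ s := by linarith
  induction d with
  | zero => simp
  | succ d ih =>
    have h1 : u ^ d ≤ s ^ d := pow_le_pow_left₀ hu (huv.trans hvs) d
    have h2 : u ^ d ≤ v ^ d := pow_le_pow_left₀ hu huv d
    have h3 : v * ((v ^ d - u ^ d) * s) ≤ s * (d * (v - u) * s ^ d) :=
      mul_le_mul hvs ih (mul_nonneg (by linarith) hs) hs
    have h4 : u ^ d * ((v - u) * s) ≤ s ^ d * ((v - u) * s) :=
      mul_le_mul_of_nonneg_right h1 (mul_nonneg (by linarith) hs)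
    push_cast
    calc (v ^ (d + 1) - u ^ (d + 1)) * s
        = v * ((v ^ d - u ^ d) * s) + u ^ d * ((v - u) * s) := by ring
      _ ≤ s * (d * (v - u) * s ^ d) + s ^ d * ((v - u) * s) := add_le_add h3 h4
      _ = (d + 1) * (v - u) * s ^ (d + 1) := by ring

theorem volume_annulus_le {d : ℕ} (hd : 1 ≤ d) {u v s : ℝ} (huv : u ≤ v) (hvs : v ≤ s)
    (hs0 : 0 < s) (hs1 : s ≤ 1) :
    (volume : Measure (Context d)).real {x | u ≤ dist x 0 ∧ dist x 0 ≤ v} * s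
      ≤ d * (v - u) * s ^ d := by
  have hnn : 0 ≤ d * (v - u) * s ^ d :=
    mul_nonneg (mul_nonneg (Nat.cast_nonneg _) (by linarith)) (by positivity)
  rcases lt_or_ge v 0 with hv | hv
  · have : {x : Context d | u ≤ dist x 0 ∧ dist x 0 ≤ v} = ∅ := by
      ext x
      simp only [Set.mem_ofPred_eq, Set.mem_empty_iff_false, iff_false, not_and, not_le]
      intro _
      have : 0 ≤ dist x 0 := dist_nonneg
      linarith
    rw [this]
    simpa using hnn
  · rcases lt_or_ge 0 u with hu | hu
    · have hsub : {x : Context d | u ≤ dist x 0 ∧ dist x 0 ≤ v}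
          = {x | dist x 0 ≤ v} \ {x | dist x 0 < u} := by
        ext x
        simp only [Set.mem_ofPred_eq, Set.mem_sdiff, not_lt, and_comm]
      have hincl : {x : Context d | dist x 0 < u} ⊆ {x | dist x 0 ≤ v} :=
        fun x (hx : dist x 0 < u) => (hx.le.trans huv : dist x 0 ≤ v)
      have hmeas : MeasurableSet {x : Context d | dist x 0 < u} :=
        measurableSet_lt (by fun_prop) measurable_const
      rw [hsub, measureReal_sdiff hincl hmeas,
        volume_dist_zero_le hv (hvs.trans hs1),
        volume_dist_zero_lt hu (huv.trans (hvs.trans hs1))]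
      exact pow_sub_pow_mul_le hu.le huv hvs d
    · have hle : (volume : Measure (Context d)).real {x | u ≤ dist x 0 ∧ dist x 0 ≤ v} ≤ v ^ d := by
        rw [← volume_dist_zero_le hv (hvs.trans hs1)]
        exact measureReal_mono fun x hx => hx.2
      have h0 := pow_sub_pow_mul_le le_rfl hv hvs d
      rw [zero_pow (by omega), sub_zero, sub_zero] at h0
      refine (mul_le_mul_of_nonneg_right hle hs0.le).trans (h0.trans ?_)
      gcongr
      linarith

/-- The margin condition for a tent. For `δ ≥ Δ` the support is small enough; for `δ < Δ` the set
consists of two layers of width `(δ / L) ^ (1 / β)`, which is at most `s (δ / Δ) ^ α`. -/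
theorem volume_tent_le {d : ℕ} (hd : 1 ≤ d) {β L Δ a w α C₀ s δ : ℝ} (hβ : 0 < β) (hL : 0 < L)
    (hΔ : 0 < Δ) (hα0 : 0 < α) (hα1 : α ≤ 1 / β) (hs0 : 0 < s) (hs1 : s ≤ 1)
    (haw : a - w + (Δ / L) ^ (1 / β) ≤ s) (haw' : a + w ≤ s) (hr : (Δ / L) ^ (1 / β) ≤ s)
    (hC : 4 * d * s ^ d ≤ C₀ * Δ ^ α) (hδ : 0 < δ) :
    (volume : Measure (Context d)).real
      {x | 0 < tent β L Δ a w (dist x 0) ∧ tent β L Δ a w (dist x 0) ≤ δ} ≤ C₀ / 2 * δ ^ α := by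
  have hd' : (1 : ℝ) ≤ d := by exact_mod_cast hd
  have hsd : 0 < s ^ d := by positivity
  have hΔα : 0 < Δ ^ α := by positivity
  have hC0 : 0 ≤ C₀ := by
    by_contra h
    have : C₀ * Δ ^ α < 0 := mul_neg_of_neg_of_pos (not_le.1 h) hΔα
    have : 0 < 4 * d * s ^ d := by positivity
    linarith
  rcases lt_or_ge δ Δ with h | h
  · set r := (δ / L) ^ (1 / β) with hrdef
    have hr0 : 0 ≤ r := by positivity
    have hrr : r ≤ (Δ / L) ^ (1 / β) * (δ / Δ) ^ α := by
      have h1 : r = (Δ / L) ^ (1 / β) * (δ / Δ) ^ (1 / β) := by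
        rw [hrdef, ← Real.mul_rpow (by positivity) (by positivity)]
        congr 1
        field_simp
      rw [h1]
      refine mul_le_mul_of_nonneg_left ?_ (by positivity)
      exact Real.rpow_le_rpow_of_exponent_ge (by positivity) (by rw [div_le_one hΔ]; exact h.le) hα1
    have hrs : r ≤ s * (δ / Δ) ^ α :=
      hrr.trans (mul_le_mul_of_nonneg_right hr (by positivity))
    have hrΔ : r ≤ (Δ / L) ^ (1 / β) :=
      Real.rpow_le_rpow (by positivity) (by gcongr) (by positivity)
    have hsub : {x : Context d | 0 < tent β L Δ a w (dist x 0) ∧ tent β L Δ a w (dist x 0) ≤ δ} ⊆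
        {x | a - w ≤ dist x 0 ∧ dist x 0 ≤ a - w + r} ∪
          {x | a + w - r ≤ dist x 0 ∧ dist x 0 ≤ a + w} := fun x hx =>
      mem_layers_of_tent_le hβ hL hΔ h hx.1 hx.2
    have h1 := volume_annulus_le hd (u := a - w) (v := a - w + r) (s := s) (by linarith)
      (by linarith) hs0 hs1
    have h2 := volume_annulus_le hd (u := a + w - r) (v := a + w) (s := s) (by linarith)
      (by linarith) hs0 hs1
    have h3 := (measureReal_mono hsub (h₂ := measure_ne_top _ _)).trans (measureReal_union_le
      (μ := (volume : Measure (Context d))) _ _)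
    refine le_of_mul_le_mul_right ?_ hs0
    refine (mul_le_mul_of_nonneg_right h3 hs0.le).trans ?_
    rw [Real.div_rpow hδ.le hΔ.le] at hrs
    have h4 : 4 * d * s ^ d * (s * (δ ^ α / Δ ^ α)) ≤ C₀ * Δ ^ α * (s * (δ ^ α / Δ ^ α)) :=
      mul_le_mul_of_nonneg_right hC (by positivity)
    have h5 : C₀ * Δ ^ α * (s * (δ ^ α / Δ ^ α)) = C₀ * δ ^ α * s := by field_simp
    have h6 : 4 * d * s ^ d * r ≤ 4 * d * s ^ d * (s * (δ ^ α / Δ ^ α)) :=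
      mul_le_mul_of_nonneg_left hrs (by positivity)
    rw [add_mul]
    have e1 : a - w + r - (a - w) = r := by ring
    have e2 : a + w - (a + w - r) = r := by ring
    rw [e1] at h1
    rw [e2] at h2
    linarith
  · have hsub : {x : Context d | 0 < tent β L Δ a w (dist x 0) ∧ tent β L Δ a w (dist x 0) ≤ δ} ⊆
        {x | dist x 0 ≤ s} := fun x hx => by
      by_contra hcon
      have hcon : s < dist x 0 := not_le.1 hcon
      have h0 := hx.1
      rw [tent_eq_zero hβ hΔ (by rw [le_abs]; left; linarith)] at h0
      exact lt_irrefl _ h0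
    have h1 := measureReal_mono hsub (μ := (volume : Measure (Context d))) (h₂ := measure_ne_top _ _)
    rw [volume_dist_zero_le hs0.le hs1] at h1
    have h2 : Δ ^ α ≤ δ ^ α := Real.rpow_le_rpow hΔ.le h hα0.le
    have h3 : C₀ * Δ ^ α ≤ C₀ * δ ^ α := mul_le_mul_of_nonneg_left h2 hC0
    have h4 : 2 * s ^ d ≤ 4 * d * s ^ d := by nlinarith
    linarith

/-- Two tents with disjoint supports, low and narrow enough in terms of `C₀`, are the payoff
functions of a problem of the class. -/
theorem exists_tent_problem {d : ℕ} (hd : 1 ≤ d) {β L Δ α C₀ s ρlo ρhi : ℝ} (hβ : 0 < β)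
    (hβ1 : β ≤ 1) (hL : 0 < L) (hΔ : 0 < Δ) (hΔ1 : Δ ≤ 1) (hα0 : 0 < α) (hα1 : α ≤ 1 / β)
    (hs0 : 0 < s) (hs1 : s ≤ 1) (hr : (Δ / L) ^ (1 / β) ≤ s)
    (hC : 4 * d * s ^ d ≤ C₀ * Δ ^ α) (hlo : ρlo ≤ 1) (hhi : 1 ≤ ρhi) (a w : Arm → ℝ)
    (haw : ∀ k, a k - w k + (Δ / L) ^ (1 / β) ≤ s) (haw' : ∀ k, a k + w k ≤ s)
    (hdisj : ∀ ρ : ℝ, 0 ≤ ρ → w 0 ≤ |ρ - a 0| ∨ w 1 ≤ |ρ - a 1|) :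
    ∃ P ∈ problemClass d β L α C₀ ρlo ρhi, P.covariate = volume ∧
      ∀ k x, P.payoff k x = tent β L Δ (a k) (w k) (dist x 0) := by
  let f : Arm → Context d → ℝ := fun k x => tent β L Δ (a k) (w k) (dist x 0)
  have hf : ∀ k, Measurable (f k) := fun k => measurable_tent.comp (by fun_prop)
  have h0 : ∀ k x, 0 ≤ f k x := fun k x => tent_nonneg hL hΔ _
  have h1 : ∀ k x, f k x ≤ 1 := fun k x => (tent_le _).trans hΔ1
  have hp := payoff_bernoulliProblem f hf h0 h1
  refine ⟨bernoulliProblem f hf h0 h1, ⟨fun k x y => ?_, ⟨fun _ => 1, measurable_const,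
    fun _ => ⟨hlo, hhi⟩, ?_⟩, fun δ hδ _ => ?_⟩, rfl, hp⟩
  · rw [hp, hp]
    refine (abs_tent_sub_le hβ hβ1 hL _ _).trans ?_
    refine mul_le_mul_of_nonneg_left (Real.rpow_le_rpow (abs_nonneg _) ?_ hβ.le) hL.le
    rw [dist_comm x y]
    exact abs_dist_sub_le y x 0
  · simp only [ENNReal.ofReal_one]
    exact withDensity_one.symm
  · simp only [hp]
    have hsub : {x : Context d | 0 < |f 0 x - f 1 x| ∧ |f 0 x - f 1 x| ≤ δ} ⊆
        {x | 0 < f 0 x ∧ f 0 x ≤ δ} ∪ {x | 0 < f 1 x ∧ f 1 x ≤ δ} := by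
      intro x hx
      obtain ⟨hx1, hx2⟩ := hx
      rcases hdisj (dist x 0) dist_nonneg with h | h
      · have hz : f 0 x = 0 := tent_eq_zero hβ hΔ h
        rw [hz, zero_sub, abs_neg, abs_of_nonneg (h0 1 x)] at hx1 hx2
        exact Or.inr ⟨hx1, hx2⟩
      · have hz : f 1 x = 0 := tent_eq_zero hβ hΔ h
        rw [hz, sub_zero, abs_of_nonneg (h0 0 x)] at hx1 hx2
        exact Or.inl ⟨hx1, hx2⟩
    have hm := (measureReal_mono hsub (h₂ := measure_ne_top _ _)).trans (measureReal_union_le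
      (μ := (volume : Measure (Context d))) _ _)
    have hv := fun k => volume_tent_le hd hβ hL hΔ hα0 hα1 hs0 hs1 (haw k) (haw' k) hr hC hδ
    have := hv 0
    have := hv 1
    refine hm.trans ?_
    linarith

end ABSE

/-! ### Linear regret of an oversmoothing policy -/

namespace ABSE

section Oversmoothing

variable {d : ℕ} {b c₀ : ℝ} {T : ℕ}

/-- If the mean reward of arm `0` over a cell exceeds that of arm `1` by much more than the
elimination threshold at the splitting time, then with a probability bounded below the bin is never
split: a split needs the collected rewards to be close to each other. -/
theorem le_prob_not_split (P : Problem d) (hc : 0 < c₀) (k : ℕ) (x : Context d) {m₀ m₁ : ℝ}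
    (h0 : ∫ z in cell k x, P.payoff 0 z ∂P.covariate = m₀ * P.covariate.real (cell k x))
    (h1 : ∫ z in cell k x, P.payoff 1 z ∂P.covariate = m₁ * P.covariate.real (cell k x))
    (hm0 : 0 ≤ m₀) (hD0 : 0 < m₀ - m₁) (hD1 : m₀ - m₁ ≤ 1)
    (hD : 8 * c₀ * ((2 : ℝ)⁻¹ ^ k) ^ b ≤ m₀ - m₁) (n : ℕ) :
    (m₀ - m₁) / 3 ≤ P.law.real {ω | ¬ (runStates d b c₀ T ω n (binOf k x)).split} := by
  set S := {ω | (runStates d b c₀ T ω n (binOf k x)).split} with hS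
  have hSm : MeasurableSet S :=
    past_le n _ (measurableSet_past_state x n k fun s => s.split)
  have hSc : {ω | ¬ (runStates d b c₀ T ω n (binOf k x)).split} = Sᶜ := rfl
  rw [hSc, probReal_compl_eq_one_sub hSm]
  have hp1 : P.law.real S ≤ 1 := measureReal_le_one
  by_cases hk : k < maxDepth d b T
  swap
  · have : S = ∅ := by
      ext ω
      simp only [hS, Set.mem_ofPred_eq, Set.mem_empty_iff_false, iff_false]
      exact fun h => hk (lt_maxDepth_of_split ω n _ h)
    rw [this, measureReal_empty]
    linarith
  set ℓ : ℝ := ((maxRounds d b c₀ T k : ℕ) : ℝ) with hℓ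
  have hℓ0 : 0 < ℓ := Nat.cast_pos.2 (maxRounds_spec (d := d) (b := b) (T := T) (k := k) hc).1
  have hψ : ∀ s : BinState, |(fun _ : BinState => (1 : ℝ)) s| ≤ 1 := by simp
  have eg := integral_pullSum (b := b) (c₀ := c₀) (T := T) P x k 0 hψ n
  have eh := integral_pullSum (b := b) (c₀ := c₀) (T := T) P x k 1 hψ n
  have e0 := integral_rewardSum (b := b) (c₀ := c₀) (T := T) P x k 0 hψ n
  have e1 := integral_rewardSum (b := b) (c₀ := c₀) (T := T) P x k 1 hψ n
  have ig := integrable_pullSum (b := b) (c₀ := c₀) (T := T) P x k 0 hψ n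
  have ih := integrable_pullSum (b := b) (c₀ := c₀) (T := T) P x k 1 hψ n
  have i0 := integrable_rewardSum (b := b) (c₀ := c₀) (T := T) P x k 0 hψ n
  have i1 := integrable_rewardSum (b := b) (c₀ := c₀) (T := T) P x k 1 hψ n
  rw [h0] at e0
  rw [h1] at e1
  have hgh : ∫ ω, pullSum b c₀ T x k 1 (fun _ => 1) n ω ∂P.law
      ≤ ∫ ω, pullSum b c₀ T x k 0 (fun _ => 1) n ω ∂P.law :=
    integral_mono ih ig fun ω => (isBinRun ω x k).armSum_one_le_armSum_zero hc n
  have hh : ℓ * P.law.real S ≤ ∫ ω, pullSum b c₀ T x k 1 (fun _ => 1) n ω ∂P.law := by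
    rw [mul_comm, ← smul_eq_mul, ← integral_indicator_const ℓ hSm]
    refine integral_mono ((integrable_const ℓ).indicator hSm) ih fun ω => ?_
    by_cases hω : ω ∈ S
    · rw [Set.indicator_of_mem hω]
      exact ((isBinRun ω x k).of_split hc hω).1.ge
    · rw [Set.indicator_of_notMem hω]
      exact armSum_nonneg 1 (fun _ => zero_le_one) n
  have hr : ∫ ω, (rewardSum b c₀ T x k 0 (fun _ => 1) n ω - rewardSum b c₀ T x k 1 (fun _ => 1) n ω)
      ∂P.law ≤ ∫ ω, (ℓ - S.indicator (fun _ => ℓ * (1 - (m₀ - m₁) / 2)) ω) ∂P.law := by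
    refine integral_mono (i0.sub i1) ((integrable_const ℓ).sub
      ((integrable_const _).indicator hSm)) fun ω => ?_
    have hrun := isBinRun (b := b) (c₀ := c₀) (T := T) ω x k
    simp only [rewardSum, runSum, one_mul]
    by_cases hω : ω ∈ S
    · rw [Set.indicator_of_mem hω]
      refine (hrun.of_split hc hω).2.trans ?_
      rw [← hℓ]
      nlinarith
    · rw [Set.indicator_of_notMem hω]
      have a1 := armSum_nonneg (s := fun t => runStates d b c₀ T ω t (binOf k x))
        (c := Visits b c₀ T x k ω) 1 (fun t => rewardValue_nonneg
        (potential (runStates d b c₀ T ω t (binOf k x)).nextArm (ω t))) n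
      have a2 := armSum_mono_weight (s := fun t => runStates d b c₀ T ω t (binOf k x))
        (c := Visits b c₀ T x k ω) 0 (fun t => rewardValue_le_one
        (potential (runStates d b c₀ T ω t (binOf k x)).nextArm (ω t))) n
      have a3 := hrun.armSum_le_maxRounds hc hk n
      linarith
  rw [integral_sub i0 i1, integral_sub (integrable_const ℓ) ((integrable_const _).indicator hSm),
    integral_indicator_const _ hSm, integral_const, probReal_univ, smul_eq_mul, smul_eq_mul,
    one_mul] at hr
  set p := P.law.real S
  have hp0 : 0 ≤ p := measureReal_nonneg
  have h2 := mul_le_mul_of_nonneg_left hgh hm0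
  have h3 := mul_le_mul_of_nonneg_left hh hD0.le
  have h4 : ℓ * ((m₀ - m₁) * p) ≤ ℓ * (1 - p * (1 - (m₀ - m₁) / 2)) := by
    rw [eg, eh] at h2
    rw [eh] at h3
    nlinarith
  have h5 := le_of_mul_le_mul_left h4 hℓ0
  nlinarith

/-- While a bin is not split, `ABSE` uses the same arm on the whole bin. -/
theorem ofReal_le_regret_of_mean_gap (P : Problem d) (hc : 0 < c₀) (k : ℕ) (x : Context d)
    {m₀ m₁ G : ℝ}
    (h0 : ∫ z in cell k x, P.payoff 0 z ∂P.covariate = m₀ * P.covariate.real (cell k x))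
    (h1 : ∫ z in cell k x, P.payoff 1 z ∂P.covariate = m₁ * P.covariate.real (cell k x))
    (hm0 : 0 ≤ m₀) (hD0 : 0 < m₀ - m₁) (hD1 : m₀ - m₁ ≤ 1)
    (hD : 8 * c₀ * ((2 : ℝ)⁻¹ ^ k) ^ b ≤ m₀ - m₁)
    (hG0 : 0 ≤ G) (hG : ∀ a, G ≤ ∫ z in cell k x, loss P a z ∂P.covariate) (n : ℕ) :
    ENNReal.ofReal ((m₀ - m₁) / 3 * G * n) ≤ (abse d b c₀ T).regret P n := by
  refine le_trans (ENNReal.ofReal_le_ofReal ?_) (ofReal_sum_le_regret P k n (fun _ : Unit => x)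
    fun _ _ _ _ _ => rfl)
  have : (m₀ - m₁) / 3 * G * n = ∑ t ∈ Finset.range n, (m₀ - m₁) / 3 * G := by
    rw [Finset.sum_const, Finset.card_range, nsmul_eq_mul, mul_comm]
  rw [this]
  refine Finset.sum_le_sum fun t _ => ?_
  simp only [Finset.univ_unique, Finset.sum_singleton]
  have h2 := le_prob_not_split (T := T) P hc k x h0 h1 hm0 hD0 hD1 hD t
  have h3 : {ω | ¬ (runStates d b c₀ T ω t (binOf k x)).split}
      ⊆ ⋃ a ∈ (Finset.univ : Finset Arm), pullEvent b c₀ T x k a t := fun ω hω => by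
    obtain ⟨j, hj, hl⟩ := exists_isLive hω
    exact Set.mem_iUnion₂.2 ⟨_, Finset.mem_univ _, j, hj, hl, rfl⟩
  have h4 := (measureReal_mono h3 (h₂ := measure_ne_top _ _)).trans
    (measureReal_biUnion_finset_le (μ := P.law) Finset.univ _)
  calc (m₀ - m₁) / 3 * G ≤ (∑ a, P.law.real (pullEvent b c₀ T x k a t)) * G :=
        mul_le_mul_of_nonneg_right (h2.trans h4) hG0
    _ = ∑ a, P.law.real (pullEvent b c₀ T x k a t) * G := Finset.sum_mul _ _ _
    _ ≤ _ := Finset.sum_le_sum fun a _ => mul_le_mul_of_nonneg_left (hG a) measureReal_nonneg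

theorem mul_measureReal_le_setIntegral {Ω : Type*} [MeasurableSpace Ω] {μ : Measure Ω}
    [IsFiniteMeasure μ] {f : Ω → ℝ} {A S : Set Ω} {m M : ℝ} (hA : MeasurableSet A)
    (hS : MeasurableSet S) (hAS : A ⊆ S) (hf : Measurable f) (hf0 : ∀ z, 0 ≤ f z)
    (hfM : ∀ z, f z ≤ M) (hfA : ∀ z ∈ A, m ≤ f z) : m * μ.real A ≤ ∫ z in S, f z ∂μ := by
  have hfi : Integrable f μ := Integrable.of_bound hf.aestronglyMeasurable M
    (ae_of_all _ fun z => by rw [Real.norm_eq_abs, abs_of_nonneg (hf0 z)]; exact hfM z)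
  rw [← integral_indicator hS, mul_comm, ← smul_eq_mul, ← integral_indicator_const m hA]
  refine integral_mono ((integrable_const m).indicator hA) (hfi.indicator hS) fun z => ?_
  by_cases hz : z ∈ A
  · rw [Set.indicator_of_mem hz, Set.indicator_of_mem (hAS hz)]; exact hfA z hz
  · rw [Set.indicator_of_notMem hz]; exact Set.indicator_nonneg (fun _ _ => hf0 _) _

theorem setIntegral_le_mul_measureReal {Ω : Type*} [MeasurableSpace Ω] {μ : Measure Ω}
    [IsFiniteMeasure μ] {f : Ω → ℝ} {A S : Set Ω} {M : ℝ} (hA : MeasurableSet A)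
    (hS : MeasurableSet S) (hf : Measurable f) (hf0 : ∀ z, 0 ≤ f z)
    (hfM : ∀ z, f z ≤ M) (hM : 0 ≤ M) (hfA : ∀ z, z ∉ A → f z = 0) :
    ∫ z in S, f z ∂μ ≤ M * μ.real A := by
  have hfi : Integrable f μ := Integrable.of_bound hf.aestronglyMeasurable M
    (ae_of_all _ fun z => by rw [Real.norm_eq_abs, abs_of_nonneg (hf0 z)]; exact hfM z)
  rw [← integral_indicator hS, mul_comm, ← smul_eq_mul, ← integral_indicator_const M hA]
  refine integral_mono (hfi.indicator hS) ((integrable_const M).indicator hA) fun z => ?_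
  by_cases hz : z ∈ A
  · rw [Set.indicator_of_mem hz]
    exact Set.indicator_le' (fun _ _ => hfM _) (fun _ _ => hM) _
  · rw [Set.indicator_of_notMem hz]
    by_cases hz2 : z ∈ S
    · rw [Set.indicator_of_mem hz2, hfA z hz]
    · rw [Set.indicator_of_notMem hz2]

theorem three_pow_add_two_pow_lt {d : ℕ} (hd : 1 ≤ d) : (3 : ℝ) ^ d + 2 ^ d < 7 ^ d := by
  induction d, hd using Nat.le_induction with
  | base => norm_num
  | succ d _ ih =>
    have h3 : (0 : ℝ) < 3 ^ d := by positivity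
    have h2 : (0 : ℝ) < 2 ^ d := by positivity
    rw [pow_succ, pow_succ, pow_succ]
    linarith

/-- Arm `0` has the larger mean on a fine enough cell at the origin, by an amount of the order of
`2 ^ (-kβ)`, which exceeds the elimination threshold of the order of `2 ^ (-kb)`; but arm `1` is
better close to the origin. -/
theorem ofReal_le_regret_of_tents (hd : 1 ≤ d) {β L Δ s : ℝ} (hβ : 0 < β) (hL : 0 < L)
    (hΔ : 0 < Δ) (hΔ1 : Δ ≤ 1) (k : ℕ) (hs : s = (2 : ℝ)⁻¹ ^ k)
    (hr : (Δ / L) ^ (1 / β) = s / 8) (hc : 0 < c₀)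
    (hD : 8 * c₀ * s ^ b ≤ Δ * ((7 ^ d - 3 ^ d - 2 ^ d) / 8 ^ d)) {P : Problem d}
    (hP : P.covariate = volume) {a w : Arm → ℝ} (ha0 : a 0 = 5 * s / 8) (hw0 : w 0 = 3 * s / 8)
    (ha1 : a 1 = 0) (hw1 : w 1 = s / 4)
    (hf : ∀ k x, P.payoff k x = tent β L Δ (a k) (w k) (dist x 0)) :
    ∃ c : ℝ, 0 < c ∧ ∀ T n : ℕ, ENNReal.ofReal (c * n) ≤ (abse d b c₀ T).regret P n := by
  have hs0 : 0 < s := by rw [hs]; positivity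
  have hs1 : s ≤ 1 := by rw [hs]; exact pow_le_one₀ (by norm_num) (by norm_num)
  have hsd : 0 < s ^ d := by positivity
  set κ : ℝ := (7 ^ d - 3 ^ d - 2 ^ d) / 8 ^ d with hκ
  have hκ0 : 0 < κ := div_pos (by linarith [three_pow_add_two_pow_lt hd]) (by positivity)
  let A : Set (Context d) := {x | dist x 0 ≤ 7 * s / 8} \ {x | dist x 0 ≤ 3 * s / 8}
  let A' : Set (Context d) := {x | dist x 0 ≤ s / 8}
  let A'' : Set (Context d) := {x | dist x 0 ≤ s / 4}
  have hball : ∀ u : ℝ, MeasurableSet {x : Context d | dist x 0 ≤ u} := fun u =>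
    measurableSet_le (by fun_prop) measurable_const
  have hAm : MeasurableSet A := (hball _).diff (hball _)
  have hA'm : MeasurableSet A' := hball _
  have hA''m : MeasurableSet A'' := hball _
  have hincl : {x : Context d | dist x 0 ≤ 3 * s / 8} ⊆ {x | dist x 0 ≤ 7 * s / 8} :=
    fun x (hx : dist x 0 ≤ 3 * s / 8) => (by linarith : dist x 0 ≤ 7 * s / 8)
  have hAv : P.covariate.real A = (7 * s / 8) ^ d - (3 * s / 8) ^ d := by
    rw [hP, measureReal_sdiff hincl (hball _), volume_dist_zero_le (by linarith) (by linarith),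
      volume_dist_zero_le (by linarith) (by linarith)]
  have hA'v : P.covariate.real A' = (s / 8) ^ d := by
    rw [hP, volume_dist_zero_le (by linarith) (by linarith)]
  have hA''v : P.covariate.real A'' = (s / 4) ^ d := by
    rw [hP, volume_dist_zero_le (by linarith) (by linarith)]
  have hcell := measurableSet_cell k (0 : Context d)
  have hAc : A ⊆ cell k 0 := fun x hx => mem_cell_zero_of_dist_lt (by
    have : dist x 0 ≤ 7 * s / 8 := hx.1
    rw [← hs]; linarith)
  have hA'c : A' ⊆ cell k 0 := fun x (hx : dist x 0 ≤ s / 8) => mem_cell_zero_of_dist_lt (by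
    rw [← hs]; linarith)
  have hcv : P.covariate.real (cell k (0 : Context d)) = s ^ d := by
    rw [hP, volume_cell, hs]
  have f0A : ∀ z ∈ A, P.payoff 0 z = Δ := fun z hz => by
    have h1 : dist z 0 ≤ 7 * s / 8 := hz.1
    have h2 : 3 * s / 8 < dist z 0 := not_le.1 hz.2
    rw [hf]
    refine tent_eq_height hβ hL hΔ ?_
    rw [hr, ha0, hw0]
    have : |dist z 0 - 5 * s / 8| ≤ s / 4 := abs_le.2 ⟨by linarith, by linarith⟩
    linarith
  have f1A : ∀ z, z ∉ A'' → P.payoff 1 z = 0 := fun z hz => by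
    have h1 : s / 4 < dist z 0 := not_le.1 hz
    rw [hf]
    refine tent_eq_zero hβ hΔ ?_
    rw [ha1, hw1, sub_zero, le_abs]
    left; linarith
  have f0A' : ∀ z ∈ A', P.payoff 0 z = 0 := fun z hz => by
    have h1 : dist z 0 ≤ s / 8 := hz
    rw [hf]
    refine tent_eq_zero hβ hΔ ?_
    rw [ha0, hw0, le_abs]
    right; linarith
  have f1A' : ∀ z ∈ A', P.payoff 1 z = Δ := fun z hz => by
    have h1 : dist z 0 ≤ s / 8 := hz
    rw [hf]
    refine tent_eq_height hβ hL hΔ ?_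
    rw [hr, ha1, hw1, sub_zero, abs_of_nonneg dist_nonneg]
    linarith
  have hfΔ : ∀ k z, P.payoff k z ≤ Δ := fun k z => by rw [hf]; exact tent_le _
  have hI0 : Δ * P.covariate.real A ≤ ∫ z in cell k 0, P.payoff 0 z ∂P.covariate :=
    mul_measureReal_le_setIntegral hAm hcell hAc (measurable_payoff P 0) (payoff_nonneg P 0)
      (hfΔ 0) fun z hz => (f0A z hz).ge
  have hI1 : ∫ z in cell k 0, P.payoff 1 z ∂P.covariate ≤ Δ * P.covariate.real A'' :=
    setIntegral_le_mul_measureReal hA''m hcell (measurable_payoff P 1) (payoff_nonneg P 1)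
      (hfΔ 1) hΔ.le f1A
  have hI0' : ∫ z in cell k 0, P.payoff 0 z ∂P.covariate ≤ Δ * P.covariate.real (cell k 0) := by
    have := setIntegral_mono_on (μ := P.covariate) (s := cell k 0) (f := P.payoff 0)
      (g := fun _ => Δ) (Integrable.of_bound (measurable_payoff P 0).aestronglyMeasurable 1
        (ae_of_all _ fun z => by
          rw [Real.norm_eq_abs, abs_of_nonneg (payoff_nonneg P 0 z)]
          exact payoff_le_one P 0 z)).integrableOn (integrable_const _).integrableOn hcell
        fun z _ => hfΔ 0 z
    rwa [setIntegral_const, smul_eq_mul, mul_comm] at this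
  have hI1' : 0 ≤ ∫ z in cell k 0, P.payoff 1 z ∂P.covariate :=
    setIntegral_nonneg hcell fun z _ => payoff_nonneg P 1 z
  rw [hAv] at hI0
  rw [hA''v] at hI1
  rw [hcv] at hI0'
  set I0 := ∫ z in cell k 0, P.payoff 0 z ∂P.covariate with hI0def
  set I1 := ∫ z in cell k 0, P.payoff 1 z ∂P.covariate with hI1def
  have hdiff : Δ * κ * s ^ d ≤ I0 - I1 := by
    have : Δ * κ * s ^ d = Δ * ((7 * s / 8) ^ d - (3 * s / 8) ^ d) - Δ * (s / 4) ^ d := by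
      have e : s / 4 = 2 * s / 8 := by ring
      rw [e, div_pow, div_pow, div_pow, mul_pow, mul_pow, mul_pow, hκ]
      field_simp
    linarith
  have hD' : Δ * κ ≤ I0 / s ^ d - I1 / s ^ d := by
    rw [← sub_div, le_div_iff₀ hsd]; exact hdiff
  have hpos : 0 < I0 / s ^ d - I1 / s ^ d := (mul_pos hΔ hκ0).trans_le hD'
  have hm0 : I0 / s ^ d ≤ 1 := by
    rw [div_le_one hsd]
    nlinarith
  have hm1 : 0 ≤ I1 / s ^ d := div_nonneg hI1' hsd.le
  let G : ℝ := min (Δ * (s / 8) ^ d) (Δ * ((7 * s / 8) ^ d - (3 * s / 8) ^ d))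
  have hG : 0 < G := lt_min (by positivity) (mul_pos hΔ (sub_pos.2
    (pow_lt_pow_left₀ (by linarith) (by linarith) (by omega))))
  have hGa : ∀ a, G ≤ ∫ z in cell k 0, loss P a z ∂P.covariate := fun a => by
    fin_cases a
    · refine (min_le_left _ _).trans ?_
      rw [← hA'v]
      refine mul_measureReal_le_setIntegral hA'm hcell hA'c (measurable_loss P 0)
        (loss_nonneg P 0) (loss_le_one P 0) fun z hz => ?_
      change Δ ≤ loss P 0 z
      rw [loss, f0A' z hz, f1A' z hz, sub_zero]
      exact le_max_right _ _
    · refine (min_le_right _ _).trans ?_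
      rw [← hAv]
      refine mul_measureReal_le_setIntegral hAm hcell hAc (measurable_loss P 1)
        (loss_nonneg P 1) (loss_le_one P 1) fun z hz => ?_
      have hz' : z ∉ A'' := fun h => by
        have h1 : dist z 0 ≤ s / 4 := h
        have h2 : 3 * s / 8 < dist z 0 := not_le.1 hz.2
        linarith
      change Δ ≤ loss P 1 z
      rw [loss, f0A z hz, f1A z hz', sub_zero]
      exact le_max_left _ _
  refine ⟨(I0 / s ^ d - I1 / s ^ d) / 3 * G, by positivity, fun T n => ?_⟩
  refine ofReal_le_regret_of_mean_gap P hc k 0 ?_ ?_ ?_ hpos (by linarith) ?_ hG.le hGa n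
  · rw [hcv, div_mul_cancel₀ _ hsd.ne']
  · rw [hcv, div_mul_cancel₀ _ hsd.ne']
  · linarith
  · rw [← hs]; linarith

theorem tendsto_two_inv_pow_rpow {e : ℝ} (he : 0 < e) :
    Filter.Tendsto (fun k : ℕ => ((2 : ℝ)⁻¹ ^ k) ^ e) Filter.atTop (nhds 0) := by
  have h1 : Filter.Tendsto (fun k : ℕ => (2 : ℝ)⁻¹ ^ k) Filter.atTop (nhds 0) :=
    tendsto_pow_atTop_nhds_zero_of_lt_one (by norm_num) (by norm_num)
  have := h1.rpow_const (p := e) (Or.inr he.le)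
  rwa [Real.zero_rpow he.ne'] at this

/-- Linear regret when the policy is tuned for too smooth payoff functions. -/
theorem exists_linear_regret (hd : 1 ≤ d) {β L α C₀ ρlo ρhi : ℝ} (hβ : 0 < β) (hβ1 : β ≤ 1)
    (hα0 : 0 < α) (hα1 : α ≤ 1 / β) (hL : 0 < L) (hC : 0 < C₀)
    (hC' : α * β < d ∨ 4 * d * (8 : ℝ) ^ (α * β) / L ^ α ≤ C₀) (hlo : ρlo ≤ 1) (hhi : 1 ≤ ρhi)
    (hc : 0 < c₀) (hb : β < b) :
    ∃ P ∈ problemClass d β L α C₀ ρlo ρhi, ∃ c : ℝ, 0 < c ∧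
      ∀ T n : ℕ, ENNReal.ofReal (c * n) ≤ (abse d b c₀ T).regret P n := by
  have hd0 : (1 : ℝ) ≤ d := by exact_mod_cast hd
  have hLα : 0 < L ^ α := by positivity
  set κ : ℝ := (7 ^ d - 3 ^ d - 2 ^ d) / 8 ^ d with hκ
  have hκ0 : 0 < κ := div_pos (by linarith [three_pow_add_two_pow_lt hd]) (by positivity)
  -- The bin is so fine that the gap at its scale dominates the threshold and that the margin
  -- condition holds.
  have ev1 : ∀ᶠ k : ℕ in Filter.atTop, ((2 : ℝ)⁻¹ ^ k) ^ β ≤ 8 ^ β / L :=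
    (tendsto_two_inv_pow_rpow hβ).eventually (ge_mem_nhds (by positivity))
  have ev2 : ∀ᶠ k : ℕ in Filter.atTop,
      ((2 : ℝ)⁻¹ ^ k) ^ (b - β) ≤ L * κ / (8 * c₀ * 8 ^ β) :=
    (tendsto_two_inv_pow_rpow (by linarith)).eventually (ge_mem_nhds (by positivity))
  have ev3 : ∀ᶠ k : ℕ in Filter.atTop,
      4 * d * (8 : ℝ) ^ (α * β) / L ^ α * ((2 : ℝ)⁻¹ ^ k) ^ ((d : ℝ) - α * β) ≤ C₀ := by
    rcases hC' with h | h
    · have := (tendsto_two_inv_pow_rpow (e := (d : ℝ) - α * β) (by linarith)).const_mul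
        (4 * d * (8 : ℝ) ^ (α * β) / L ^ α)
      rw [mul_zero] at this
      exact this.eventually (ge_mem_nhds hC)
    · refine Filter.Eventually.of_forall fun k => le_trans ?_ h
      refine mul_le_of_le_one_right (by positivity) ?_
      refine Real.rpow_le_one (by positivity) (pow_le_one₀ (by norm_num) (by norm_num)) ?_
      have : α * β ≤ 1 := by rwa [le_div_iff₀ hβ] at hα1
      linarith
  obtain ⟨k, h1, h2, h3⟩ := (ev1.and (ev2.and ev3)).exists
  set s : ℝ := (2 : ℝ)⁻¹ ^ k with hs
  have hs0 : 0 < s := by positivity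
  have hs1 : s ≤ 1 := pow_le_one₀ (by norm_num) (by norm_num)
  set Δ : ℝ := L * (s / 8) ^ β with hΔdef
  have hΔ : 0 < Δ := by positivity
  have hΔ' : Δ = L * s ^ β / 8 ^ β := by
    rw [hΔdef, Real.div_rpow hs0.le (by norm_num), mul_div_assoc]
  have hΔ1 : Δ ≤ 1 := by
    rw [hΔ', div_le_one (by positivity)]
    rw [le_div_iff₀ hL] at h1
    linarith
  have hr : (Δ / L) ^ (1 / β) = s / 8 := by
    rw [hΔdef, mul_div_cancel_left₀ _ hL.ne', ← Real.rpow_mul (by positivity),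
      mul_one_div_cancel hβ.ne', Real.rpow_one]
  have hΔα : Δ ^ α = L ^ α * s ^ (α * β) / 8 ^ (α * β) := by
    rw [hΔ', Real.div_rpow (by positivity) (by positivity), Real.mul_rpow hL.le (by positivity),
      ← Real.rpow_mul hs0.le, ← Real.rpow_mul (by norm_num), mul_comm β]
  have hCC : 4 * d * s ^ d ≤ C₀ * Δ ^ α := by
    have e : s ^ ((d : ℝ) - α * β) * s ^ (α * β) = s ^ d := by
      rw [← Real.rpow_add hs0, sub_add_cancel, Real.rpow_natCast]
    have := mul_le_mul_of_nonneg_right h3 (by positivity : 0 ≤ Δ ^ α)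
    refine le_trans (le_of_eq ?_) this
    rw [hΔα, ← e]
    field_simp
  let a : Arm → ℝ := ![5 * s / 8, 0]
  let w : Arm → ℝ := ![3 * s / 8, s / 4]
  obtain ⟨P, hP, hPv, hPf⟩ := exists_tent_problem hd hβ hβ1 hL hΔ hΔ1 hα0 hα1 hs0 hs1
    (by rw [hr]; linarith) hCC hlo hhi a w
    (by rw [hr]; intro k; fin_cases k <;> simp [a, w] <;> linarith)
    (by intro k; fin_cases k <;> simp [a, w] <;> linarith)
    (by
      intro ρ hρ
      rcases le_total ρ (s / 4) with h | h
      · left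
        rw [le_abs]; right
        simp only [a, w, Matrix.cons_val_zero]
        linarith
      · right
        rw [le_abs]; left
        simp only [a, w, Matrix.cons_val_one, Matrix.cons_val_fin_one]
        linarith)
  refine ⟨P, hP, ofReal_le_regret_of_tents hd hβ hL hΔ hΔ1 k hs hr hc ?_ hPv rfl rfl rfl rfl hPf⟩
  rw [← hκ, hΔ']
  have e : s ^ (b - β) * s ^ β = s ^ b := by rw [← Real.rpow_add hs0, sub_add_cancel]
  rw [le_div_iff₀ (by positivity)] at h2
  have := mul_le_mul_of_nonneg_right h2 (by positivity : 0 ≤ s ^ β)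
  rw [div_mul_eq_mul_div, le_div_iff₀ (by positivity), ← e]
  linarith

end Oversmoothing

end ABSE

/-! ### Survival of both arms when the gap is small -/

namespace ABSE

section Undersmoothing

variable {d : ℕ} {b c₀ : ℝ} {T : ℕ}

theorem IsBinRun.active_ne_mono {k : ℕ} {s : ℕ → BinState} {c : ℕ → Prop} {y : ℕ → Bool}
    (hr : IsBinRun d b c₀ T k s c y) {m n : ℕ} (hmn : m ≤ n)
    (h : (s m).active ≠ Finset.univ) : (s n).active ≠ Finset.univ := by
  induction n, hmn using Nat.le_induction with
  | base => exact h
  | succ n _ ih =>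
    by_cases hc : c n
    · rw [hr.succ_of_visit n hc, (BinState.step_of_active_ne ih _).1]; exact ih
    · rw [hr.succ_of_not_visit n hc]; exact ih

/-- An arm has been eliminated in the bin of depth `j` containing `x` before period `t`. -/
def elimEvent (b c₀ : ℝ) (T : ℕ) (x : Context d) (j t : ℕ) :
    Set (ℕ → Context d × (Bool × Bool)) :=
  {ω | (runStates d b c₀ T ω t (binOf j x)).active ≠ Finset.univ}

theorem measurableSet_elimEvent (x : Context d) (j t : ℕ) :
    MeasurableSet (elimEvent b c₀ T x j t) :=
  past_le t _ (measurableSet_past_state x t j fun s => s.active ≠ Finset.univ)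

/-- If the payoffs are at most `Δ`, then an elimination is unlikely as long as `Δ` is small compared
with the inverse square root of the number `N` of visits: it needs the weighted rewards to exceed
`θ`, and their expectation is at most `2 Δ √N`. -/
theorem prob_elimEvent_mul_le (P : Problem d) (hc : 0 < c₀) (j : ℕ) (x : Context d) {Δ N θ : ℝ}
    (hΔ : 0 ≤ Δ) (hP : ∀ i z, P.payoff i z ≤ Δ) (hN0 : 0 < N) (n : ℕ)
    (hN : ∫ ω, (pullSum b c₀ T x j 0 (fun _ => 1) n ω + pullSum b c₀ T x j 1 (fun _ => 1) n ω)
      ∂P.law ≤ N)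
    (hθ : ∀ p : ℕ, 1 ≤ p → (j < maxDepth d b T → p ≤ maxRounds d b c₀ T j) →
      θ ≤ √(2 * p) * radius p (localHorizon d T j)) :
    P.law.real (elimEvent b c₀ T x j n) * θ ≤ 2 * Δ * √N := by
  have hψ : ∀ s : BinState, |(fun _ : BinState => (1 : ℝ)) s| ≤ 1 := by simp
  have hv : ∀ s : BinState, |visitWeight s| ≤ 1 := fun s => by
    rw [abs_of_nonneg (visitWeight_nonneg s)]; exact visitWeight_le_one s
  have ip := fun i => integrable_pullSum (b := b) (c₀ := c₀) (T := T) P x j i hψ n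
  have iz := fun i => integrable_pullSum (b := b) (c₀ := c₀) (T := T) P x j i hv n
  have ir := fun i => integrable_rewardSum (b := b) (c₀ := c₀) (T := T) P x j i hv n
  have hW : P.law.real (elimEvent b c₀ T x j n) * θ ≤
      ∫ ω, (rewardSum b c₀ T x j 0 visitWeight n ω + rewardSum b c₀ T x j 1 visitWeight n ω)
        ∂P.law := by
    have hEm := measurableSet_elimEvent (b := b) (c₀ := c₀) (T := T) x j n
    rw [← smul_eq_mul, ← integral_indicator_const θ hEm]
    refine integral_mono ((integrable_const θ).indicator hEm) ((ir 0).add (ir 1)) fun ω => ?_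
    have hrun := isBinRun (b := b) (c₀ := c₀) (T := T) ω x j
    by_cases hω : ω ∈ elimEvent b c₀ T x j n
    · rw [Set.indicator_of_mem hω]
      exact (hrun.le_of_active_ne hc hθ n).2 hω
    · rw [Set.indicator_of_notMem hω]
      exact add_nonneg
        (armSum_nonneg 0 (fun t => mul_nonneg (visitWeight_nonneg _) (rewardValue_nonneg _)) n)
        (armSum_nonneg 1 (fun t => mul_nonneg (visitWeight_nonneg _) (rewardValue_nonneg _)) n)
  have hrz : ∀ i, ∫ ω, rewardSum b c₀ T x j i visitWeight n ω ∂P.law ≤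
      Δ * ∫ ω, pullSum b c₀ T x j i visitWeight n ω ∂P.law := fun i => by
    rw [integral_rewardSum P x j i hv, integral_pullSum P x j i hv]
    have h1 : ∫ z in cell j x, P.payoff i z ∂P.covariate ≤ Δ * P.covariate.real (cell j x) := by
      have := setIntegral_mono_on (μ := P.covariate) (s := cell j x) (f := P.payoff i)
        (g := fun _ => Δ) (Integrable.of_bound (measurable_payoff P i).aestronglyMeasurable 1
          (ae_of_all _ fun z => by
            rw [Real.norm_eq_abs, abs_of_nonneg (payoff_nonneg P i z)]
            exact payoff_le_one P i z)).integrableOn (integrable_const _).integrableOn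
          (measurableSet_cell j x) fun z _ => hP i z
      rwa [setIntegral_const, smul_eq_mul, mul_comm] at this
    have h2 := mul_le_mul_of_nonneg_left h1
      (armMass_nonneg (b := b) (c₀ := c₀) (T := T) P x j i visitWeight_nonneg n)
    linarith
  have hz : ∫ ω, (pullSum b c₀ T x j 0 visitWeight n ω + pullSum b c₀ T x j 1 visitWeight n ω)
      ∂P.law ≤ 2 * √N := by
    have hsN : 0 < √N := Real.sqrt_pos.2 hN0
    have h1 : ∫ ω, (pullSum b c₀ T x j 0 visitWeight n ω + pullSum b c₀ T x j 1 visitWeight n ω)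
        ∂P.law ≤ ∫ ω, ((√N)⁻¹ * (pullSum b c₀ T x j 0 (fun _ => 1) n ω +
          pullSum b c₀ T x j 1 (fun _ => 1) n ω) + √N) ∂P.law := by
      refine integral_mono ((iz 0).add (iz 1))
        ((((ip 0).add (ip 1)).const_mul _).add (integrable_const _)) fun ω => ?_
      have hrun := isBinRun (b := b) (c₀ := c₀) (T := T) ω x j
      refine (hrun.sum_visitWeight_le hc n).trans ?_
      change 2 * √(pullSum b c₀ T x j 0 (fun _ => 1) n ω + pullSum b c₀ T x j 1 (fun _ => 1) n ω)
        ≤ _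
      have hV : 0 ≤ pullSum b c₀ T x j 0 (fun _ => 1) n ω +
          pullSum b c₀ T x j 1 (fun _ => 1) n ω :=
        add_nonneg (armSum_nonneg 0 (fun _ => zero_le_one) n)
          (armSum_nonneg 1 (fun _ => zero_le_one) n)
      generalize pullSum b c₀ T x j 0 (fun _ => 1) n ω +
          pullSum b c₀ T x j 1 (fun _ => 1) n ω = V at hV ⊢
      -- arithmetic-geometric mean inequality
      have hsq := Real.sq_sqrt hV
      refine le_of_mul_le_mul_left ?_ hsN
      have e : √N * ((√N)⁻¹ * V + √N) = V + √N ^ 2 := by field_simp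
      rw [e]
      nlinarith [sq_nonneg (√V - √N)]
    refine h1.trans ?_
    have ipp : Integrable (fun ω => pullSum b c₀ T x j 0 (fun _ => 1) n ω +
        pullSum b c₀ T x j 1 (fun _ => 1) n ω) P.law := (ip 0).add (ip 1)
    rw [integral_add (ipp.const_mul _) (integrable_const _), integral_const_mul,
      integral_const, probReal_univ, one_smul]
    have h2 := mul_le_mul_of_nonneg_left hN (inv_nonneg.2 hsN.le)
    have h3 : (√N)⁻¹ * N = √N := by
      rw [inv_mul_eq_div, Real.div_sqrt]
    linarith
  rw [integral_add (ir 0) (ir 1)] at hW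
  rw [integral_add (iz 0) (iz 1)] at hz
  have h0 := hrz 0
  have h1 := hrz 1
  have h2 := mul_le_mul_of_nonneg_left hz hΔ
  linarith

/-- Below the maximal depth, the number of visits is bounded by the number of rounds, and the
radius at the last round is known. -/
theorem prob_elimEvent_le_of_lt (P : Problem d) (hc : 0 < c₀) (hb : 0 < b) {j : ℕ}
    (hj : j < maxDepth d b T) (x : Context d) {Δ : ℝ}
    (hΔ : 0 ≤ Δ) (hP : ∀ i z, P.payoff i z ≤ Δ) (n : ℕ) :
    P.law.real (elimEvent b c₀ T x j n) ≤ 2 * Δ / min 1 (c₀ / 2) * ((2 : ℝ) ^ b) ^ j := by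
  have hψ : ∀ s : BinState, |(fun _ : BinState => (1 : ℝ)) s| ≤ 1 := by simp
  have ip := fun i => integrable_pullSum (b := b) (c₀ := c₀) (T := T) P x j i hψ n
  have hℓ1 := (maxRounds_spec (d := d) (b := b) (T := T) (k := j) hc).1
  have hrad := le_radius_maxRounds (d := d) (b := b) (T := T) (k := j) hc
  set m := maxRounds d b c₀ T j with hm
  have hm0 : (0 : ℝ) < m := Nat.cast_pos.2 hℓ1
  have hq : ((2 : ℝ)⁻¹ ^ j) ^ b * ((2 : ℝ) ^ b) ^ j = 1 := by
    rw [← Real.rpow_natCast, ← Real.rpow_natCast, ← Real.rpow_mul (by norm_num),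
      ← Real.rpow_mul (by norm_num), mul_comm b, ← Real.mul_rpow (by norm_num) (by norm_num)]
    norm_num
  have hq1 : ((2 : ℝ)⁻¹ ^ j) ^ b ≤ 1 :=
    Real.rpow_le_one (by positivity) (pow_le_one₀ (by norm_num) (by norm_num)) hb.le
  set q := ((2 : ℝ)⁻¹ ^ j) ^ b with hqdef
  have hq0 : 0 < q := by positivity
  have hM : 0 < min 1 (c₀ / 2) := lt_min one_pos (by positivity)
  have hrad' : min 1 (c₀ / 2) * q ≤ radius m (localHorizon d T j) := by
    refine le_trans (le_min ?_ ?_) hrad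
    · exact mul_le_one₀ (min_le_left _ _) hq0.le hq1
    · exact mul_le_mul_of_nonneg_right (min_le_right _ _) hq0.le
  have hrad0 : 0 < radius m (localHorizon d T j) := (mul_pos hM hq0).trans_le hrad'
  have h := prob_elimEvent_mul_le (b := b) (T := T) P hc j x (N := 2 * m)
    (θ := √(2 * m) * radius m (localHorizon d T j)) hΔ hP (by positivity) n ?_ ?_
  · have hs : 0 < √(2 * (m : ℝ)) := Real.sqrt_pos.2 (by positivity)
    have h1 : P.law.real (elimEvent b c₀ T x j n) * radius m (localHorizon d T j) ≤ 2 * Δ := by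
      refine le_of_mul_le_mul_right ?_ hs
      linarith
    have h2 : P.law.real (elimEvent b c₀ T x j n) * (min 1 (c₀ / 2) * q) ≤ 2 * Δ :=
      (mul_le_mul_of_nonneg_left hrad' measureReal_nonneg).trans h1
    rw [div_mul_eq_mul_div, le_div_iff₀ hM]
    have h3 : 0 < ((2 : ℝ) ^ b) ^ j := by positivity
    have h4 := mul_le_mul_of_nonneg_right h2 h3.le
    have h5 : P.law.real (elimEvent b c₀ T x j n) * (min 1 (c₀ / 2) * q) * ((2 : ℝ) ^ b) ^ j
      = P.law.real (elimEvent b c₀ T x j n) * min 1 (c₀ / 2) * (q * ((2 : ℝ) ^ b) ^ j) := by ring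
    rw [h5, hq, mul_one] at h4
    exact h4
  · calc ∫ ω, (pullSum b c₀ T x j 0 (fun _ => 1) n ω + pullSum b c₀ T x j 1 (fun _ => 1) n ω)
        ∂P.law ≤ ∫ _, (2 * (m : ℝ)) ∂P.law := by
          refine integral_mono ((ip 0).add (ip 1)) (integrable_const _) fun ω => ?_
          have hrun := isBinRun (b := b) (c₀ := c₀) (T := T) ω x j
          have h1 : pullSum b c₀ T x j 0 (fun _ => 1) n ω ≤ m :=
            hrun.armSum_le_maxRounds hc hj n
          have h2 : pullSum b c₀ T x j 1 (fun _ => 1) n ω ≤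
              pullSum b c₀ T x j 0 (fun _ => 1) n ω := hrun.armSum_one_le_armSum_zero hc n
          change pullSum b c₀ T x j 0 (fun _ => 1) n ω + pullSum b c₀ T x j 1 (fun _ => 1) n ω ≤ _
          linarith
      _ = 2 * m := by simp
  · intro p hp1 hp
    have := radius_mul_sqrt_anti (localHorizon_nonneg d T j) hp1 (hp hj)
    rw [Real.sqrt_mul (by norm_num), Real.sqrt_mul (by norm_num)]
    have := mul_le_mul_of_nonneg_left this (Real.sqrt_nonneg 2)
    linarith

theorem sum_prob_armEvent_le_one (P : Problem d) (x : Context d) (j t : ℕ) :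
    P.law.real (armEvent b c₀ T x j 0 t) + P.law.real (armEvent b c₀ T x j 1 t) ≤ 1 := by
  rw [← measureReal_union _ (measurableSet_armEvent x j 1 t)]
  · exact measureReal_le_one
  · refine Set.disjoint_left.2 fun ω h0 h1 => ?_
    have := h0.2.2.symm.trans h1.2.2
    exact absurd this (by decide)

/-- In any bin the expected number of visits is at most the expected number of contexts. -/
theorem prob_elimEvent_le (P : Problem d) (hP0 : P.covariate = volume) (hT : 1 ≤ T) (hc : 0 < c₀)
    (j : ℕ) (x : Context d) {Δ : ℝ} (hΔ : 0 ≤ Δ) (hP : ∀ i z, P.payoff i z ≤ Δ) :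
    P.law.real (elimEvent b c₀ T x j T) ≤ Δ * √(localHorizon d T j) := by
  have hψ : ∀ s : BinState, |(fun _ : BinState => (1 : ℝ)) s| ≤ 1 := by simp
  have ip := fun i => integrable_pullSum (b := b) (c₀ := c₀) (T := T) P x j i hψ T
  have hT0 : (0 : ℝ) < T := Nat.cast_pos.2 hT
  have hpos : 0 < localHorizon d T j := by unfold localHorizon; positivity
  have h := prob_elimEvent_mul_le (b := b) (T := T) P hc j x (N := localHorizon d T j)
    (θ := 2) hΔ hP hpos T ?_ ?_
  · linarith
  · rw [integral_add (ip 0) (ip 1), integral_pullSum P x j 0 hψ, integral_pullSum P x j 1 hψ,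
      armMass_one, armMass_one, ← add_mul, ← Finset.sum_add_distrib, hP0, volume_cell,
      localHorizon]
    refine mul_le_mul_of_nonneg_right ?_ (by positivity)
    refine (Finset.sum_le_sum fun t _ => sum_prob_armEvent_le_one P x j t).trans ?_
    simp
  · intro p hp1 _
    have h1 := one_le_radius_mul_sqrt hp1 (localHorizon d T j)
    have h2 : (1 : ℝ) ≤ √2 := by rw [Real.one_le_sqrt]; norm_num
    rw [Real.sqrt_mul (by norm_num)]
    nlinarith

/-- As the arms alternate, arm `1` is the next one at `x` in at least a quarter of the periods on
average, provided that
the bins containing `x` keep both arms with sufficient probability and are visited often. -/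
theorem le_sum_prob_pullEvent (P : Problem d) (hc : 0 < c₀) (x : Context d)
    (helim : ∑ j ∈ Finset.range (maxDepth d b T + 1), P.law.real (elimEvent b c₀ T x j T) ≤ 1 / 4)
    (hpos : ∀ j, 0 < P.covariate.real (cell j x))
    (hvis : ∑ j ∈ Finset.range (maxDepth d b T + 1), 1 / P.covariate.real (cell j x)
      ≤ (T : ℝ) / 4) :
    (T : ℝ) / 4 ≤ ∑ t ∈ Finset.range T,
      P.law.real (pullEvent b c₀ T x (maxDepth d b T) 1 t) := by
  set K := maxDepth d b T with hK
  set M : ℕ → Arm → ℝ := fun j i => armMass P b c₀ T x j i (fun _ => 1) T with hM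
  have hψ : ∀ s : BinState, |(fun _ : BinState => (1 : ℝ)) s| ≤ 1 := by simp
  -- the two arms alternate within each bin
  have halt : ∀ j, M j 0 ≤ M j 1 + 1 / P.covariate.real (cell j x) := fun j => by
    have ip := fun i => integrable_pullSum (b := b) (c₀ := c₀) (T := T) P x j i hψ T
    have h1 : ∫ ω, pullSum b c₀ T x j 0 (fun _ => 1) T ω ∂P.law ≤
        ∫ ω, (pullSum b c₀ T x j 1 (fun _ => 1) T ω + 1) ∂P.law :=
      integral_mono (ip 0) ((ip 1).add (integrable_const _)) fun ω =>
        (isBinRun (b := b) (c₀ := c₀) (T := T) ω x j).armSum_zero_le_add_one hc T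
    rw [integral_add (ip 1) (integrable_const _), integral_pullSum P x j 0 hψ,
      integral_pullSum P x j 1 hψ, integral_const, probReal_univ, one_smul] at h1
    rw [← sub_le_iff_le_add', le_div_iff₀ (hpos j)]
    simp only [hM]
    linarith
  -- each period is spent in one of the bins
  have hper : ∀ t ∈ Finset.range T, 1 ≤ ∑ j ∈ Finset.range (K + 1),
      (P.law.real (armEvent b c₀ T x j 0 t) + P.law.real (armEvent b c₀ T x j 1 t) +
        P.law.real (elimEvent b c₀ T x j T)) := fun t ht => by
    have hsub : (Set.univ : Set (ℕ → Context d × (Bool × Bool))) ⊆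
        ⋃ j ∈ Finset.range (K + 1), ((armEvent b c₀ T x j 0 t ∪ armEvent b c₀ T x j 1 t) ∪
          elimEvent b c₀ T x j T) := fun ω _ => by
      obtain ⟨j, hj, hl⟩ := exists_isLive (not_split_maxDepth (b := b) (c₀ := c₀) (T := T) ω t x)
      refine Set.mem_iUnion₂.2 ⟨j, Finset.mem_range.2 (by omega), ?_⟩
      by_cases ha : (runStates d b c₀ T ω t (binOf j x)).active = Finset.univ
      · left
        rcases Fin.exists_fin_two.1 ⟨_, rfl⟩ with h | h
        · exact Or.inl ⟨hl, ha, h⟩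
        · exact Or.inr ⟨hl, ha, h⟩
      · right
        exact (isBinRun (b := b) (c₀ := c₀) (T := T) ω x j).active_ne_mono
          (Finset.mem_range.1 ht).le ha
    have h1 := measureReal_mono hsub (μ := P.law) (h₂ := measure_ne_top _ _)
    rw [probReal_univ] at h1
    refine h1.trans ((measureReal_biUnion_finset_le _ _).trans (Finset.sum_le_sum fun j _ => ?_))
    have h2 := measureReal_union_le (μ := P.law)
      (armEvent b c₀ T x j 0 t ∪ armEvent b c₀ T x j 1 t) (elimEvent b c₀ T x j T)
    have h3 := measureReal_union_le (μ := P.law) (armEvent b c₀ T x j 0 t)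
      (armEvent b c₀ T x j 1 t)
    linarith
  have htot : (T : ℝ) ≤ ∑ j ∈ Finset.range (K + 1), (M j 0 + M j 1) + T / 4 := by
    have h1 := Finset.sum_le_sum hper
    rw [Finset.sum_const, Finset.card_range, nsmul_eq_mul, mul_one, Finset.sum_comm] at h1
    simp only [Finset.sum_add_distrib, Finset.sum_const, Finset.card_range, nsmul_eq_mul] at h1
    rw [← Finset.mul_sum] at h1
    have h2 := mul_le_mul_of_nonneg_left helim (Nat.cast_nonneg (α := ℝ) T)
    simp only [hM, armMass_one, Finset.sum_add_distrib]
    linarith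
  have hle : ∑ j ∈ Finset.range (K + 1), M j 1 ≤
      ∑ t ∈ Finset.range T, P.law.real (pullEvent b c₀ T x K 1 t) := by
    simp only [hM, armMass_one]
    rw [Finset.sum_comm]
    refine Finset.sum_le_sum fun t _ => ?_
    rw [← measureReal_biUnion_finset (fun i _ j _ hij => Set.disjoint_left.2 fun ω hi hj =>
      hij (hi.1.unique hj.1)) fun j _ => measurableSet_armEvent x j 1 t]
    refine measureReal_mono (Set.iUnion₂_subset fun j hj ω hω => ?_) (measure_ne_top _ _)
    exact ⟨j, by have := Finset.mem_range.1 hj; omega, hω.1, hω.2.2⟩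
  have hs := Finset.sum_le_sum fun j (_ : j ∈ Finset.range (K + 1)) => halt j
  rw [Finset.sum_add_distrib] at hs htot
  linarith

/-- If arm `1` is the next one in a quarter of the periods everywhere, then the regret is at least a
quarter of what always pulling this arm loses. -/
theorem ofReal_le_regret_of_pulls (P : Problem d)
    (h : ∀ x, (T : ℝ) / 4 ≤ ∑ t ∈ Finset.range T,
      P.law.real (pullEvent b c₀ T x (maxDepth d b T) 1 t)) :
    ENNReal.ofReal ((T : ℝ) / 4 * ∫ z, loss P 1 z ∂P.covariate) ≤ (abse d b c₀ T).regret P T := by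
  set K := maxDepth d b T
  refine le_trans (ENNReal.ofReal_le_ofReal ?_) (ofReal_sum_le_regret P K T (corner K)
    fun y v w hv hw => (existsUnique_mem_cell_corner K y).unique hv hw)
  have hli : Integrable (loss P 1) P.covariate :=
    Integrable.of_bound (measurable_loss P 1).aestronglyMeasurable 1 (ae_of_all _ fun z => by
      rw [Real.norm_eq_abs, abs_of_nonneg (loss_nonneg P 1 z)]
      exact loss_le_one P 1 z)
  have hpart : ∫ z, loss P 1 z ∂P.covariate =
      ∑ v, ∫ z in cell K (corner K v), loss P 1 z ∂P.covariate := by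
    rw [← integral_iUnion_fintype (fun v => measurableSet_cell K _) (fun v w hvw =>
      Set.disjoint_left.2 fun y hv hw => hvw ((existsUnique_mem_cell_corner K y).unique hv hw))
      fun v => hli.integrableOn]
    have : ⋃ v, cell K (corner (d := d) K v) = Set.univ :=
      Set.eq_univ_of_forall fun y => Set.mem_iUnion.2 (existsUnique_mem_cell_corner K y).exists
    rw [this, setIntegral_univ]
  have hI : ∀ a v, 0 ≤ ∫ z in cell K (corner K v), loss P a z ∂P.covariate := fun a v =>
    setIntegral_nonneg (measurableSet_cell K _) fun z _ => loss_nonneg P a z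
  rw [hpart, Finset.mul_sum, Finset.sum_comm]
  refine Finset.sum_le_sum fun v _ => ?_
  refine (mul_le_mul_of_nonneg_right (h (corner K v)) (hI 1 v)).trans ?_
  rw [Finset.sum_mul]
  refine Finset.sum_le_sum fun t _ => ?_
  rw [Fin.sum_univ_two]
  have := mul_nonneg (measureReal_nonneg (μ := P.law)
    (s := pullEvent b c₀ T (corner K v) K 0 t)) (hI 0 v)
  linarith

end Undersmoothing

end ABSE

/-! ### Regret at the finest resolution -/

namespace ABSE

section Resolution

variable {d : ℕ} {b c₀ : ℝ} {T : ℕ}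

/-- The finest resolution `(2 log 2 / T) ^ (1 / (2 b + d))` of the policy. -/
noncomputable def resolution (d : ℕ) (b : ℝ) (T : ℕ) : ℝ :=
  (2 * Real.log 2 / T) ^ (1 / (2 * b + d))

theorem two_log_two_pos : 0 < 2 * Real.log 2 := mul_pos two_pos (Real.log_pos one_lt_two)

theorem resolution_pos (hT : 1 ≤ T) : 0 < resolution d b T := by
  have : (0 : ℝ) < T := Nat.cast_pos.2 hT
  have := two_log_two_pos
  unfold resolution
  positivity

theorem resolution_rpow (hb : 0 < b) (u : ℝ) :
    resolution d b T ^ u = (2 * Real.log 2 / T) ^ (u / (2 * b + d)) := by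
  have := two_log_two_pos
  have hbd : 0 < 2 * b + d := by positivity
  rw [resolution, ← Real.rpow_mul (by positivity)]
  congr 1
  field_simp

theorem mul_resolution_rpow (hb : 0 < b) (hT : 1 ≤ T) :
    T * resolution d b T ^ (2 * b + d) = 2 * Real.log 2 := by
  have : (0 : ℝ) < T := Nat.cast_pos.2 hT
  have hbd : 0 < 2 * b + d := by positivity
  rw [resolution_rpow hb, div_self hbd.ne', Real.rpow_one]
  field_simp

theorem tendsto_resolution (d : ℕ) (hb : 0 < b) :
    Filter.Tendsto (fun T => resolution d b T) Filter.atTop (nhds 0) := by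
  have h1 := tendsto_const_div_atTop_nhds_zero_nat (2 * Real.log 2)
  have hbd : 0 < 1 / (2 * b + d) := by positivity
  have := h1.rpow_const (p := 1 / (2 * b + d)) (Or.inr hbd.le)
  rwa [Real.zero_rpow hbd.ne'] at this

/-- The bins of maximal depth have side length of the order of the resolution. -/
theorem maxDepth_spec (hT : 1 ≤ T) (h1 : resolution d b T ≤ 1) :
    resolution d b T / 2 ≤ (2 : ℝ)⁻¹ ^ maxDepth d b T ∧
      (2 : ℝ)⁻¹ ^ maxDepth d b T ≤ resolution d b T := by
  have hpos := resolution_pos (d := d) (b := b) hT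
  obtain ⟨k, hk⟩ := exists_pow_lt_of_lt_one hpos (by norm_num : (2 : ℝ)⁻¹ < 1)
  have hmem : (2 : ℝ)⁻¹ ^ maxDepth d b T ≤ resolution d b T :=
    Nat.sInf_mem (s := {k : ℕ | (2 : ℝ)⁻¹ ^ k ≤ (2 * Real.log 2 / T) ^ (1 / (2 * b + d))})
      ⟨k, hk.le⟩
  refine ⟨?_, hmem⟩
  rcases Nat.eq_zero_or_pos (maxDepth d b T) with h | h
  · rw [h, pow_zero]; linarith
  · by_contra hcon
    push Not at hcon
    have h2 : (2 : ℝ)⁻¹ ^ (maxDepth d b T - 1) ≤ resolution d b T := by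
      have e : (2 : ℝ)⁻¹ ^ maxDepth d b T = (2 : ℝ)⁻¹ ^ (maxDepth d b T - 1) * 2⁻¹ := by
        rw [← pow_succ, Nat.sub_add_cancel h]
      rw [e] at hcon
      linarith
    have h3 : maxDepth d b T ≤ maxDepth d b T - 1 :=
      Nat.sInf_le (s := {k : ℕ | (2 : ℝ)⁻¹ ^ k ≤ (2 * Real.log 2 / T) ^ (1 / (2 * b + d))}) h2
    omega

theorem two_pow_maxDepth_le (hT : 1 ≤ T) (h1 : resolution d b T ≤ 1) :
    (2 : ℝ) ^ maxDepth d b T ≤ 2 / resolution d b T := by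
  have h := (maxDepth_spec hT h1).1
  have hpos := resolution_pos (d := d) (b := b) hT
  rw [inv_pow, ← one_div, div_le_div_iff₀ two_pos (by positivity)] at h
  rw [le_div_iff₀ hpos]
  linarith

/-- A bound for the total probability of an elimination in the bins containing a context, in units
of `Δ / resolution ^ b`: the first term is the geometric sum over the bins above the maximal depth,
the second belongs to the maximal depth. -/
noncomputable def elimConst (b c₀ : ℝ) : ℝ := 2 * 2 ^ b / (min 1 (c₀ / 2) * (2 ^ b - 1)) + 2

theorem one_lt_two_rpow (hb : 0 < b) : (1 : ℝ) < 2 ^ b := Real.one_lt_rpow one_lt_two hb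

theorem elimConst_pos (hb : 0 < b) (hc : 0 < c₀) : 0 < elimConst b c₀ := by
  have h1 := one_lt_two_rpow hb
  have h2 : 0 < min 1 (c₀ / 2) := lt_min one_pos (by positivity)
  have h3 : 0 < (2 : ℝ) ^ b - 1 := by linarith
  unfold elimConst
  positivity

theorem sum_prob_elimEvent_le (P : Problem d) (hP0 : P.covariate = volume) (hT : 1 ≤ T)
    (h1 : resolution d b T ≤ 1) (hb : 0 < b) (hc : 0 < c₀) (x : Context d) {Δ : ℝ} (hΔ : 0 ≤ Δ)
    (hP : ∀ i z, P.payoff i z ≤ Δ) :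
    ∑ j ∈ Finset.range (maxDepth d b T + 1), P.law.real (elimEvent b c₀ T x j T) ≤
      elimConst b c₀ * (Δ / resolution d b T ^ b) := by
  have hH := resolution_pos (d := d) (b := b) hT
  set H := resolution d b T with hHdef
  set K := maxDepth d b T with hK
  have hy := one_lt_two_rpow hb
  set y : ℝ := 2 ^ b with hydef
  have hM : 0 < min 1 (c₀ / 2) := lt_min one_pos (by positivity)
  have hT0 : (0 : ℝ) < T := Nat.cast_pos.2 hT
  rw [Finset.sum_range_succ]
  have hyK : y ^ K ≤ y / H ^ b := by
    have h2 := Real.rpow_le_rpow (by positivity) (two_pow_maxDepth_le hT h1) hb.le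
    rw [Real.div_rpow (by norm_num) hH.le, ← Real.rpow_natCast, ← Real.rpow_mul (by norm_num),
      mul_comm, Real.rpow_mul (by norm_num), Real.rpow_natCast] at h2
    exact h2
  have hfirst : ∑ j ∈ Finset.range K, P.law.real (elimEvent b c₀ T x j T) ≤
      2 * y / (min 1 (c₀ / 2) * (y - 1)) * (Δ / H ^ b) := by
    calc ∑ j ∈ Finset.range K, P.law.real (elimEvent b c₀ T x j T)
        ≤ ∑ j ∈ Finset.range K, 2 * Δ / min 1 (c₀ / 2) * y ^ j :=
          Finset.sum_le_sum fun j hj =>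
            prob_elimEvent_le_of_lt P hc hb (Finset.mem_range.1 hj) x hΔ hP T
      _ = 2 * Δ / min 1 (c₀ / 2) * ((y ^ K - 1) / (y - 1)) := by
          rw [← Finset.mul_sum, geom_sum_eq hy.ne']
      _ ≤ 2 * Δ / min 1 (c₀ / 2) * ((y / H ^ b) / (y - 1)) := by
          have : 0 < y - 1 := by linarith
          gcongr
          linarith
      _ = _ := by
          have : y - 1 ≠ 0 := by linarith
          field_simp
  have hlast : P.law.real (elimEvent b c₀ T x K T) ≤ 2 * (Δ / H ^ b) := by
    refine (prob_elimEvent_le P hP0 hT hc K x hΔ hP).trans ?_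
    have hS : localHorizon d T K ≤ (2 / H ^ b) ^ 2 := by
      calc localHorizon d T K ≤ T * H ^ d := by
            unfold localHorizon
            have := (maxDepth_spec hT h1).2
            gcongr
        _ = T * H ^ (2 * b + d) / (H ^ b) ^ 2 := by
            rw [Real.rpow_add hH, Real.rpow_natCast, mul_comm 2 b, Real.rpow_mul hH.le,
              Real.rpow_two]
            field_simp
        _ = 2 * Real.log 2 / (H ^ b) ^ 2 := by rw [mul_resolution_rpow hb hT]
        _ ≤ 4 / (H ^ b) ^ 2 := by
            have := Real.log_two_lt_d9
            gcongr
            linarith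
        _ = (2 / H ^ b) ^ 2 := by rw [div_pow]; norm_num
    have h2 : √(localHorizon d T K) ≤ 2 / H ^ b := Real.sqrt_le_iff.2 ⟨by positivity, hS⟩
    calc Δ * √(localHorizon d T K) ≤ Δ * (2 / H ^ b) := mul_le_mul_of_nonneg_left h2 hΔ
      _ = 2 * (Δ / H ^ b) := by ring
  rw [elimConst, add_mul]
  exact add_le_add hfirst hlast

theorem sum_inv_volume_cell_le (hd : 1 ≤ d) (hT : 1 ≤ T) (h1 : resolution d b T ≤ 1) (hb : 0 < b)
    (h2 : resolution d b T ^ (2 * b) ≤ Real.log 2 / (4 * 2 ^ d)) (x : Context d) :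
    ∑ j ∈ Finset.range (maxDepth d b T + 1),
      1 / (volume : Measure (Context d)).real (cell j x) ≤ (T : ℝ) / 4 := by
  have hH := resolution_pos (d := d) (b := b) hT
  set H := resolution d b T with hHdef
  set K := maxDepth d b T with hK
  have hz : (2 : ℝ) ≤ 2 ^ d := le_self_pow₀ (by norm_num) (by omega)
  have e : ∀ j, 1 / (volume : Measure (Context d)).real (cell j x) = ((2 : ℝ) ^ d) ^ j := by
    intro j
    rw [volume_cell, inv_pow, inv_pow, one_div, inv_inv, ← pow_mul, ← pow_mul, mul_comm]
  simp only [e]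
  have hgeom : ∀ n : ℕ, ∑ j ∈ Finset.range (n + 1), ((2 : ℝ) ^ d) ^ j ≤ 2 * ((2 : ℝ) ^ d) ^ n := by
    intro n
    induction n with
    | zero => simp
    | succ n ih =>
      rw [Finset.sum_range_succ]
      have : (0 : ℝ) < ((2 : ℝ) ^ d) ^ n := by positivity
      rw [pow_succ _ n]
      nlinarith
  refine (hgeom K).trans ?_
  have h3 : ((2 : ℝ) ^ d) ^ K ≤ 2 ^ d / H ^ d := by
    rw [← pow_mul, mul_comm, pow_mul, ← div_pow]
    exact pow_le_pow_left₀ (by positivity) (two_pow_maxDepth_le hT h1) d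
  have h4 := mul_resolution_rpow (d := d) hb hT
  rw [← hHdef, Real.rpow_add hH, Real.rpow_natCast] at h4
  have hHd : 0 < H ^ d := by positivity
  have hH2 : 0 < H ^ (2 * b) := by positivity
  have h5 : (T : ℝ) = 2 * Real.log 2 / (H ^ (2 * b) * H ^ d) := by
    rw [eq_div_iff (by positivity)]; exact h4
  have h6 : 2 * (2 ^ d / H ^ d) ≤ (T : ℝ) / 4 := by
    rw [h5, div_div, mul_div_assoc', div_le_div_iff₀ hHd (by positivity)]
    rw [le_div_iff₀ (by positivity)] at h2
    have := mul_le_mul_of_nonneg_right h2 hHd.le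
    linarith
  linarith

/-- For `0 < Δ` of the order of `resolution ^ b`, the tent of height `Δ` over a cube of volume of
the order of `Δ ^ α` has a regret of the order of `T Δ ^ (1 + α)`. -/
theorem ofReal_le_regret_of_tent (hd : 1 ≤ d) {β L α C₀ ρlo ρhi Δ : ℝ} (hβ : 0 < β) (hβ1 : β ≤ 1)
    (hα0 : 0 < α) (hα1 : α ≤ 1 / β) (hL : 0 < L) (hC : 0 < C₀) (hlo : ρlo ≤ 1) (hhi : 1 ≤ ρhi)
    (hb : 0 < b) (hc : 0 < c₀) (hT : 1 ≤ T) (h1 : resolution d b T ≤ 1)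
    (h2 : resolution d b T ^ (2 * b) ≤ Real.log 2 / (4 * 2 ^ d)) (hΔ : 0 < Δ) (hΔ1 : Δ ≤ 1)
    (hΔH : elimConst b c₀ * (Δ / resolution d b T ^ b) ≤ 1 / 4)
    (hη1 : C₀ * Δ ^ α ≤ 4 * d)
    (hηr : 4 * d * 2 ^ d / L ^ (d / β) * Δ ^ (d / β - α) ≤ C₀) :
    ENNReal.ofReal (T / 4 * (Δ * (C₀ * Δ ^ α / (4 * d * 2 ^ d)))) ≤
      ⨆ P ∈ problemClass d β L α C₀ ρlo ρhi, (abse d b c₀ T).regret P T := by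
  have hd0 : (0 : ℝ) < d := Nat.cast_pos.2 hd
  set V : ℝ := C₀ * Δ ^ α / (4 * d) with hV
  have hV0 : 0 < V := by positivity
  set η : ℝ := V ^ (1 / (d : ℝ)) with hη
  have hη0 : 0 < η := by positivity
  have hηd : η ^ d = V := by
    rw [hη, ← Real.rpow_natCast, ← Real.rpow_mul hV0.le, one_div_mul_cancel hd0.ne', Real.rpow_one]
  have hη_le : η ≤ 1 := Real.rpow_le_one hV0.le (by rw [hV, div_le_one (by positivity)]; exact hη1)
    (by positivity)
  set r : ℝ := (Δ / L) ^ (1 / β) with hr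
  have hr0 : 0 < r := by positivity
  have hrη : 2 * r ≤ η := by
    rw [← pow_le_pow_iff_left₀ (by positivity) hη0.le (by omega : d ≠ 0), hηd, mul_pow, hr,
      ← Real.rpow_natCast ((Δ / L) ^ (1 / β)), ← Real.rpow_mul (by positivity),
      one_div_mul_eq_div, Real.div_rpow hΔ.le hL.le, hV, le_div_iff₀ (by positivity)]
    have e : Δ ^ ((d : ℝ) / β) = Δ ^ ((d : ℝ) / β - α) * Δ ^ α := by
      rw [← Real.rpow_add hΔ, sub_add_cancel]
    rw [e]
    have := mul_le_mul_of_nonneg_right hηr (by positivity : 0 ≤ Δ ^ α)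
    refine le_trans (le_of_eq ?_) this
    field_simp
  obtain ⟨P, hPc, hPv, hPf⟩ := exists_tent_problem (ρlo := ρlo) (ρhi := ρhi) (C₀ := C₀) (s := η)
    hd hβ hβ1 hL hΔ hΔ1 hα0 hα1 hη0 hη_le (by linarith)
    (by rw [hηd, hV]; exact le_of_eq (by field_simp)) hlo hhi (fun _ => 0) ![η, 0]
    (by rw [← hr]; intro k; fin_cases k <;> simp <;> linarith)
    (by intro k; fin_cases k <;> simp; linarith)
    (fun ρ _ => Or.inr (by simp))
  have hPΔ : ∀ i z, P.payoff i z ≤ Δ := fun i z => by rw [hPf]; exact tent_le _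
  refine le_trans ?_ (le_iSup₂ (f := fun P (_ : P ∈ problemClass d β L α C₀ ρlo ρhi) =>
    (abse d b c₀ T).regret P T) P hPc)
  refine le_trans (ENNReal.ofReal_le_ofReal ?_) (ofReal_le_regret_of_pulls (b := b) (c₀ := c₀) P
    fun x => le_sum_prob_pullEvent P hc x
      ((sum_prob_elimEvent_le P hPv hT h1 hb hc x hΔ.le hPΔ).trans hΔH)
      (fun j => by rw [hPv, volume_cell]; positivity)
      (by rw [hPv]; exact sum_inv_volume_cell_le hd hT h1 hb h2 x))
  refine mul_le_mul_of_nonneg_left ?_ (by positivity)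
  have hvol : P.covariate.real {x : Context d | dist x 0 ≤ η / 2}
      = C₀ * Δ ^ α / (4 * d * 2 ^ d) := by
    rw [hPv, volume_dist_zero_le (by positivity) (by linarith), div_pow, hηd, hV, div_div]
  rw [← hvol, ← setIntegral_univ]
  refine mul_measureReal_le_setIntegral (measurableSet_le (by fun_prop) measurable_const)
    MeasurableSet.univ (Set.subset_univ _) (measurable_loss P 1) (loss_nonneg P 1)
    (loss_le_one P 1) fun z hz => ?_
  have hz' : dist z 0 ≤ η / 2 := hz
  have e0 : P.payoff 0 z = Δ := by
    rw [hPf]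
    refine tent_eq_height hβ hL hΔ ?_
    rw [sub_zero, abs_of_nonneg dist_nonneg]
    simp only [Matrix.cons_val_zero]
    linarith
  have e1 : P.payoff 1 z = 0 := by
    rw [hPf]
    exact tent_eq_zero hβ hΔ (by simp)
  rw [loss, e0, e1, sub_zero]
  exact le_max_left _ _

/-- The regret of the order of `T ^ ζ(b, α, d)`, from tents whose height is a small multiple of
`resolution ^ b`. -/
theorem exists_regret_lower_bound (hd : 1 ≤ d) {β L α C₀ ρlo ρhi : ℝ} (hβ : 0 < β) (hβ1 : β ≤ 1)
    (hα0 : 0 < α) (hα1 : α ≤ 1 / β) (hL : 0 < L) (hC : 0 < C₀)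
    (hC' : α * β < d ∨ 4 * d * 2 ^ d / L ^ (d / β) ≤ C₀) (hlo : ρlo ≤ 1) (hhi : 1 ≤ ρhi)
    (hb : 0 < b) (hc : 0 < c₀) :
    ∃ c : ℝ, 0 < c ∧ ∃ T₀ : ℕ, ∀ T : ℕ, T₀ ≤ T →
      ENNReal.ofReal (c * (T : ℝ) ^ zetaExponent b α d) ≤
        ⨆ P ∈ problemClass d β L α C₀ ρlo ρhi, (abse d b c₀ T).regret P T := by
  have hd0 : (1 : ℝ) ≤ d := by exact_mod_cast hd
  have hlog := two_log_two_pos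
  have hE := elimConst_pos hb hc
  set κ : ℝ := 1 / (4 * elimConst b c₀) with hκ
  have hκ0 : 0 < κ := by positivity
  have hHt := tendsto_resolution d hb
  have hΔt : Filter.Tendsto (fun T => κ * resolution d b T ^ b) Filter.atTop (nhds 0) := by
    have := (hHt.rpow_const (p := b) (Or.inr hb.le)).const_mul κ
    rwa [Real.zero_rpow hb.ne', mul_zero] at this
  have ev1 : ∀ᶠ T in Filter.atTop, resolution d b T ≤ 1 := hHt.eventually (ge_mem_nhds one_pos)
  have ev2 : ∀ᶠ T in Filter.atTop, resolution d b T ^ (2 * b) ≤ Real.log 2 / (4 * 2 ^ d) := by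
    have := hHt.rpow_const (p := 2 * b) (Or.inr (by positivity))
    rw [Real.zero_rpow (by positivity)] at this
    exact this.eventually (ge_mem_nhds (by have := Real.log_pos one_lt_two; positivity))
  have ev3 : ∀ᶠ T in Filter.atTop, κ * resolution d b T ^ b ≤ 1 :=
    hΔt.eventually (ge_mem_nhds one_pos)
  have ev4 : ∀ᶠ T in Filter.atTop, C₀ * (κ * resolution d b T ^ b) ^ α ≤ 4 * d := by
    have := (hΔt.rpow_const (p := α) (Or.inr hα0.le)).const_mul C₀
    rw [Real.zero_rpow hα0.ne', mul_zero] at this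
    exact this.eventually (ge_mem_nhds (by positivity))
  have ev5 : ∀ᶠ T in Filter.atTop, 4 * d * 2 ^ d / L ^ (d / β) *
      (κ * resolution d b T ^ b) ^ (d / β - α) ≤ C₀ := by
    rcases hC' with h | h
    · have hpos : 0 < d / β - α := by
        rw [sub_pos, lt_div_iff₀ hβ]; exact h
      have := (hΔt.rpow_const (p := d / β - α) (Or.inr hpos.le)).const_mul
        (4 * d * 2 ^ d / L ^ (d / β))
      rw [Real.zero_rpow hpos.ne', mul_zero] at this
      exact this.eventually (ge_mem_nhds hC)
    · filter_upwards [ev3, Filter.eventually_ge_atTop 1] with T h3 hT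
      have hH := resolution_pos (d := d) (b := b) hT
      refine le_trans (mul_le_of_le_one_right (by positivity) ?_) h
      refine Real.rpow_le_one (by positivity) h3 ?_
      have : 1 / β ≤ d / β := by gcongr
      linarith
  set e : ℝ := b * (1 + α) / (2 * b + d) with he
  refine ⟨C₀ * κ ^ (1 + α) * (2 * Real.log 2) ^ e / (16 * d * 2 ^ d), by positivity, ?_⟩
  obtain ⟨T₀, hT₀⟩ := Filter.eventually_atTop.1
    (ev1.and (ev2.and (ev3.and (ev4.and (ev5.and (Filter.eventually_ge_atTop 1))))))
  refine ⟨T₀, fun T hTT => ?_⟩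
  obtain ⟨h1, h2, h3, h4, h5, hT⟩ := hT₀ T hTT
  have hH := resolution_pos (d := d) (b := b) hT
  have hT0 : (0 : ℝ) < T := Nat.cast_pos.2 hT
  have hHb : 0 < resolution d b T ^ b := by positivity
  refine le_trans (le_of_eq ?_) (ofReal_le_regret_of_tent (Δ := κ * resolution d b T ^ b) hd hβ hβ1
    hα0 hα1 hL hC hlo hhi hb hc hT h1 h2 (by positivity) h3 ?_ h4 h5)
  · congr 1
    have e1 : κ * resolution d b T ^ b * (κ * resolution d b T ^ b) ^ α =
        κ ^ (1 + α) * ((2 * Real.log 2) ^ e / (T : ℝ) ^ e) := by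
      have : κ * resolution d b T ^ b * (κ * resolution d b T ^ b) ^ α =
          (κ * resolution d b T ^ b) ^ (1 + α) := by
        rw [Real.rpow_add (by positivity), Real.rpow_one]
      rw [this, Real.mul_rpow hκ0.le hHb.le, ← Real.rpow_mul hH.le, resolution_rpow hb,
        Real.div_rpow hlog.le hT0.le]
    have e2 : (T : ℝ) ^ zetaExponent b α d = T / (T : ℝ) ^ e := by
      rw [zetaExponent, Real.rpow_sub hT0, Real.rpow_one]
    rw [e2]
    calc _ = (T : ℝ) / 4 * (C₀ / (4 * d * 2 ^ d)) *
          (κ ^ (1 + α) * ((2 * Real.log 2) ^ e / (T : ℝ) ^ e)) := by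
            field_simp
            ring
      _ = _ := by
            rw [← e1]
            field_simp
  · rw [mul_div_assoc, div_self hHb.ne', mul_one, hκ]
    exact le_of_eq (by field_simp)

end Resolution

end ABSE

theorem mainTheorem10 (d : ℕ) (hd : 1 ≤ d) (β : ℝ) (hβ0 : 0 < β) (hβ1 : β ≤ 1)
    (α : ℝ) (hα0 : 0 < α) (hα1 : α ≤ 1 / β) (L : ℝ) (hL : 0 < L) :
    ∃ Cmin : ℝ, 0 < Cmin ∧
      ∀ C₀ : ℝ, 0 < C₀ → (α * β < d ∨ Cmin ≤ C₀) →
      ∀ ρlo ρhi : ℝ, 0 < ρlo → ρlo ≤ 1 → 1 ≤ ρhi →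
      ∀ b : ℝ, 0 < b → b ≤ 1 →
      ∀ c₀ : ℝ, 0 < c₀ →
        ∃ c : ℝ, 0 < c ∧ ∃ T₀ : ℕ, ∀ T : ℕ, T₀ ≤ T →
          (b < β →
            ENNReal.ofReal (c * (T : ℝ) ^ zetaExponent b α d) ≤
              ⨆ P ∈ problemClass d β L α C₀ ρlo ρhi, (abse d b c₀ T).regret P T) ∧
          (β < b →
            ENNReal.ofReal (c * (T : ℝ)) ≤
              ⨆ P ∈ problemClass d β L α C₀ ρlo ρhi, (abse d b c₀ T).regret P T) := by
  have hd0 : (0 : ℝ) < d := Nat.cast_pos.2 hd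
  refine ⟨max (4 * d * (8 : ℝ) ^ (α * β) / L ^ α) (4 * d * 2 ^ d / L ^ (d / β)),
    lt_max_of_lt_left (by positivity), ?_⟩
  intro C₀ hC hC' ρlo ρhi _ hlo hhi b hb0 _ c₀ hc
  rcases lt_or_ge β b with hβb | hβb
  · obtain ⟨P, hP, c, hc0, h⟩ := ABSE.exists_linear_regret hd hβ0 hβ1 hα0 hα1 hL hC
      (hC'.imp_right ((le_max_left _ _).trans ·)) hlo hhi hc hβb
    refine ⟨c, hc0, 0, fun T _ => ⟨fun hbβ => absurd hβb hbβ.not_gt, fun _ => ?_⟩⟩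
    exact (h T T).trans (le_iSup₂ (f := fun P (_ : P ∈ problemClass d β L α C₀ ρlo ρhi) =>
      (abse d b c₀ T).regret P T) P hP)
  · obtain ⟨c, hc0, T₀, h⟩ := ABSE.exists_regret_lower_bound hd hβ0 hβ1 hα0 hα1 hL hC
      (hC'.imp_right ((le_max_right _ _).trans ·)) hlo hhi hb0 hc
    exact ⟨c, hc0, T₀, fun T hT => ⟨fun _ => h T hT, fun hβb' => absurd hβb' hβb.not_gt⟩⟩
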